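/- Let $\zeta$ be the Riemann zeta function, $\mu$ the Möbius function, $(z)_n=\prod_{0\le k\le n-1}(z+k)$ the Pochhammer symbol, and $\xi(s)=\tfrac12 s(s-1)\pi^{-s/2}\Gamma(s/2)\zeta(s)$ the (entire) Riemann xi function. For $\beta\in\mathbb C$ with $\operatorname{Re}\beta\ge 0$ and integers $w\ge 0$ put $$f(s,\beta)=\frac{1}{\sin(\pi s/4)\cdot 2\xi(2\beta+s)},$$ $$P_{4w}(z,\beta)=\frac{(-1)^{w+1}}{\pi^{1-\beta}\Gamma(1+\beta)}\sum_{k\ge w+1}\frac{(-1)^k z^{2k}}{(1+\beta)_{2k}\,(2k+\beta-\frac12)\,\zeta(2\beta+4k)},$$ $$T_0(z,\beta,4w)=\frac{(-1)^{w+1}}{\pi^{1-\beta}\Gamma(1+\beta)}\sum_{k\ge w+1}\frac{(\pi z)^{2k}}{(1+\beta)_{2k}\,(2k+\beta-\frac12)}.$$ **A.** Fix $\beta$ with $\operatorname{Re}\beta\ge 0$ and set $m=\max\{0,1-2\operatorname{Re}\beta\}$. For every $w\ge0$ both series above converge absolutely for all $z\in\mathbb C$, and $P_{4w}(\cdot,\beta)$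 is entire. Moreover: 1. If $m<\operatorname{Re}s<4$, then $f(s,\beta)=\int_0^\infty v^{s-1}P_0(\pi v^{-2},\beta)\,dv$, with absolute convergence. 2. If $w\ge1$ and $4w<\operatorname{Re}s<4(w+1)$, then $(-1)^w f(s,\beta)=\int_0^\infty v^{s-1}P_{4w}(\pi v^{-2},\beta)\,dv$, with absolute convergence. 3. For all $w\ge0$ and $z\in\mathbb C$, $P_{4w}(\pi z,\beta)=\sum_{n\ge1}\mu(n)\,n^{-2\beta}\,T_0(iz/n^2,\beta,4w)$, with absolute convergence. 4. As $r\to+\infty$, $P_0(r,\beta)=O(r^{m/2})$, and $P_{4w}(r,\beta)=O(r^{2w})$ for every $w\ge1$ (the implied constants may depend on $\beta$ and $w$). **B.** Let $\beta=\tfrac14$ and write $f(s)=f(s,\tfrac14)$, $P_{4w}(z)=P_{4w}(z,\tfrac14)$, $\tilde c(4k)=1/\big(\pi^{3/4}\,\Gamma(\tfrac54+2k)\,(2k-\tfrac14)\,\zeta(\tfrac12+4k)\big)$. 1. On the strip $\tfrac12<\operatorname{Re}s<4$, $f$ is analytic and $f(s)=\int_{\mathbb R}e^{sy}P_0(\pi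 e^{-2y})\,dy$, with absolute convergence, where for all $z\in\mathbb C$ $$P_0(z)=-\frac{4}{\pi^{3/4}\Gamma(1/4)}\sum_{k\ge1}\frac{(-z^2)^k}{(5/4)_{2k}(2k-\frac14)\zeta(\frac12+4k)}=-\sum_{k\ge1}\tilde c(4k)(-z^2)^k .$$ 2. For $w\ge1$, on the strip $4w<\operatorname{Re}s<4(w+1)$, $f$ is analytic and $(-1)^wf(s)=\int_{\mathbb R}e^{sy}P_{4w}(\pi e^{-2y})\,dy$, with absolute convergence, where for all $z\in\mathbb C$ $$P_{4w}(z)=(-1)^w\Big(P_0(z)+\sum_{1\le k\le w}\tilde c(4k)(-z^2)^k\Big)=(-1)^{w+1}\sum_{k\ge w+1}\tilde c(4k)(-z^2)^k .$$ 3. For every $\varepsilon>0$, $P_0(v)=O(v^{1/4+\varepsilon})$ as $v\to+\infty$. -/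

import Mathlib

namespace XiMellin

open Complex

/-- The Riemann `ξ`-function `ξ(s) = (1/2) s (s - 1) π^(-s/2) Γ(s/2) ζ(s)`, written as an entire
function: `completedRiemannZeta₀ s = π^(-s/2) Γ(s/2) ζ(s) + 1/s + 1/(1-s)` is entire. -/
noncomputable def xi (s : ℂ) : ℂ :=
  (1 / 2) * (s * (s - 1) * completedRiemannZeta₀ s + 1)

/-- `xi` agrees with the product formula wherever the latter has no removable singularity
in the right half plane. -/
theorem xi_eq (s : ℂ) (hs : 0 < s.re) (hs1 : s ≠ 1) :
    xi s = (1 / 2) * ((Real.pi : ℂ) ^ (-s / 2) * (2 * Gamma (1 + s / 2)) * (s - 1))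
      * riemannZeta s := by
  have h0 : s ≠ 0 := by
    rintro rfl
    simp at hs
  have h1 : (1 : ℂ) - s ≠ 0 := sub_ne_zero.mpr (Ne.symm hs1)
  have hG : Gammaℝ s ≠ 0 := Gammaℝ_ne_zero_of_re_pos hs
  have hz : Gammaℝ s * riemannZeta s = completedRiemannZeta s := by
    rw [riemannZeta_def_of_ne_zero h0]
    field_simp
  have hg : Gamma (1 + s / 2) = s / 2 * Gamma (s / 2) := by
    rw [add_comm, Gamma_add_one _ (div_ne_zero h0 two_ne_zero)]
  have e : (1 / 2) * ((Real.pi : ℂ) ^ (-s / 2) * (2 * Gamma (1 + s / 2)) * (s - 1))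
      * riemannZeta s = (1 / 2) * s * (s - 1) * (Gammaℝ s * riemannZeta s) := by
    rw [hg, Gammaℝ_def]
    ring
  rw [e, hz, completedRiemannZeta_eq, xi]
  field_simp
  ring

/-- `f(s, β) = 1 / (sin(π s / 4) · 2 ξ(2β + s))`. -/
noncomputable def f (s β : ℂ) : ℂ :=
  1 / (sin (Real.pi * s / 4) * (2 * xi (2 * β + s)))

/-- The Pochhammer symbol `(z)_n = z (z + 1) ⋯ (z + n - 1)`. -/
noncomputable def poch (z : ℂ) (n : ℕ) : ℂ := (ascPochhammer ℂ n).eval z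

/-- The `k`-th term of the series for `P_{4w}(z, β)`. -/
noncomputable def PTerm (z β : ℂ) (k : ℕ) : ℂ :=
  (-1) ^ k * z ^ (2 * k) /
    (poch (1 + β) (2 * k) * (2 * k + β - 1 / 2) * riemannZeta (2 * β + 4 * k))

/-- `P w z β` is `P_{4w}(z, β)`; the sum is over `k = j + (w + 1)` with `j ≥ 0`,
that is, over `k ≥ w + 1`. -/
noncomputable def P (w : ℕ) (z β : ℂ) : ℂ :=
  ((-1) ^ (w + 1) / ((Real.pi : ℂ) ^ (1 - β) * Gamma (1 + β))) *
    ∑' j : ℕ, PTerm z β (j + (w + 1))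

/-- The `k`-th term of the series for `T_0(z, β, 4w)`. -/
noncomputable def TTerm (z β : ℂ) (k : ℕ) : ℂ :=
  (Real.pi * z) ^ (2 * k) / (poch (1 + β) (2 * k) * (2 * k + β - 1 / 2))

/-- `T0 z β w` is `T_0(z, β, 4w)`; the sum is over `k ≥ w + 1`. -/
noncomputable def T0 (z β : ℂ) (w : ℕ) : ℂ :=
  ((-1) ^ (w + 1) / ((Real.pi : ℂ) ^ (1 - β) * Gamma (1 + β))) *
    ∑' j : ℕ, TTerm z β (j + (w + 1))

/-- `cTilde k = 1 / (π^(3/4) Γ(5/4 + 2k) (2k - 1/4) ζ(1/2 + 4k))`, the coefficients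
for `β = 1/4`. -/
noncomputable def cTilde (k : ℕ) : ℂ :=
  1 / ((Real.pi : ℂ) ^ (3 / 4 : ℂ) * Gamma (5 / 4 + 2 * k) * (2 * k - 1 / 4) *
    riemannZeta (1 / 2 + 4 * k))

end XiMellin

/-!
The even part of Kummer's function `₁F₁(1; 1 + β; i u)` is
`C u = ∑ k, (-1) ^ k * u ^ (2 * k) / (1 + β)_{2 k}`. Let `C_w` be the part of this series with
`k ≥ w + 1`. Kummer's differential equation gives
`∫ t in 0..∞, t ^ β * exp (-t) * C (x t) = Γ (1 + β) / (1 + x ^ 2)` for every real `x`, beyond the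
range of the geometric series; removing the first terms, `C_w` yields
`Γ (1 + β) * (-x ^ 2) ^ (w + 1) / (1 + x ^ 2)`. The Mellin transform turns this multiplicative
convolution into a product, so the Mellin transform of `C_w` at `-q` is a multiple of
`1 / (sin (π q / 2) Γ (1 + β + q))` on the strip `2 w < Re q < 2 (w + 1)`, the factor being
independent of `w`. Division of the `k`-th coefficient by `2 k + β - 1 / 2` is integration of
dilates over `[0, 1]` and divides the transform by `q + β - 1 / 2`. Expanding
`1 / ζ (2 β + 4 k) = ∑ μ(n) n ^ (-2 β - 4 k)` writes `P w` as a superposition of dilates, which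
multiplies the transform by `1 / ζ (2 β + 2 q)`; at `q = s / 2` these factors combine to `f`.

For the growth of `P 0 (x ^ 2)`, split the Möbius sum at `n = x`. The terms beyond `x` are small by
the power series. A term with `n ≤ x` is, for `y = x / n`, a multiple of `y ^ (1 - 2 β)` minus
`2 ∫ u in 1..y, u ^ (-2 β)`, up to `O(y ^ (-2 Re β))`. Cancellation between these main terms is
needed only for `Re β ≤ 1 / 2`. It comes from `|∑_{n ≤ x} μ(n) / n| ≤ 2` and, on the line
`Re β = 1 / 2`, also from `∑_{n ≤ x} μ(n) n ^ (-s) ∑_{m ≤ x / n} m ^ (-s) = 1` for `s = 2 β`,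
together with `ζ ≠ 0` on `Re s = 1`.
-/

namespace XiMellin

open Complex Filter Topology Set MeasureTheory

variable {β : ℂ}

/-! ### Kummer's function `₁F₁(1; 1 + β; z)` -/

theorem poch_zero (b : ℂ) : poch b 0 = 1 := by simp [poch]

theorem poch_succ (b : ℂ) (n : ℕ) : poch b (n + 1) = poch b n * (b + n) := by
  simp [poch, ascPochhammer_succ_right]

theorem factorial_le_norm_poch {b : ℂ} (hb : 1 ≤ b.re) (n : ℕ) :
    (n.factorial : ℝ) ≤ ‖poch b n‖ := by
  induction n with
  | zero => simp [poch_zero]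
  | succ n ih =>
    have hn : (n : ℝ) + 1 ≤ ‖b + n‖ := by
      refine le_trans ?_ (re_le_norm _)
      rw [add_re, natCast_re]
      linarith
    rw [poch_succ, norm_mul, Nat.factorial_succ, Nat.cast_mul, mul_comm, Nat.cast_succ]
    gcongr

theorem poch_ne_zero {b : ℂ} (hb : 0 < b.re) (n : ℕ) : poch b n ≠ 0 := by
  induction n with
  | zero => simp [poch_zero]
  | succ n ih =>
    have hn : 0 < (b + n).re := by
      rw [add_re, natCast_re]
      positivity
    rw [poch_succ]
    exact mul_ne_zero ih (ne_zero_of_re_pos hn)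

theorem Gamma_add_natCast_eq_mul_poch {b : ℂ} (hb : 0 < b.re) (n : ℕ) :
    Gamma (b + n) = Gamma b * poch b n := by
  have hpole (k : ℕ) : b ≠ -k := by
    intro h
    rw [h, neg_re, natCast_re] at hb
    linarith [k.cast_nonneg (α := ℝ)]
  rw [poch, ← Gamma_add_nat_div_Gamma_eq b hpole,
    mul_div_cancel₀ _ (Gamma_ne_zero_of_re_pos hb)]

theorem one_le_re_one_add (hβ : 0 ≤ β.re) : 1 ≤ (1 + β).re := by
  rw [add_re, one_re]
  linarith

theorem re_one_add_pos (hβ : 0 ≤ β.re) : 0 < (1 + β).re :=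
  one_pos.trans_le (one_le_re_one_add hβ)

theorem norm_pow_div_poch_le {b : ℂ} (hb : 1 ≤ b.re) (z : ℂ) (n : ℕ) :
    ‖z ^ n / poch b n‖ ≤ ‖z‖ ^ n / n.factorial := by
  rw [norm_div, norm_pow]
  gcongr
  exact factorial_le_norm_poch hb n

theorem differentiable_tsum_of_norm_le_on_balls {ι : Type*} {F : ι → ℂ → ℂ} {u : ℝ → ι → ℝ}
    (hF : ∀ i, Differentiable ℂ (F i)) (hu : ∀ R, Summable (u R))
    (hFu : ∀ R i z, ‖z‖ ≤ R → ‖F i z‖ ≤ u R i) : Differentiable ℂ fun z => ∑' i, F i z := by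
  intro z
  have hball : DifferentiableOn ℂ (fun z => ∑' i, F i z) (Metric.ball 0 (‖z‖ + 1)) :=
    differentiableOn_tsum_of_summable_norm (hu (‖z‖ + 1))
      (fun i => (hF i).differentiableOn) Metric.isOpen_ball
      fun i x hx => hFu _ i x (mem_ball_zero_iff.mp hx).le
  exact hball.differentiableAt (Metric.isOpen_ball.mem_nhds (by simp))

/-- Kummer's confluent hypergeometric function `₁F₁(1; 1 + β; z) = ∑ zⁿ / (1 + β)ₙ`. -/
noncomputable def kummer (β z : ℂ) : ℂ := ∑' n : ℕ, z ^ n / poch (1 + β) n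

theorem summable_norm_pow_div_poch {b : ℂ} (hb : 1 ≤ b.re) (z : ℂ) :
    Summable fun n : ℕ => ‖z ^ n / poch b n‖ :=
  .of_nonneg_of_le (fun _ => norm_nonneg _) (norm_pow_div_poch_le hb z)
    (Real.summable_pow_div_factorial ‖z‖)

theorem hasSum_kummer (hβ : 0 ≤ β.re) (z : ℂ) :
    HasSum (fun n : ℕ => z ^ n / poch (1 + β) n) (kummer β z) :=
  (summable_norm_pow_div_poch (one_le_re_one_add hβ) z).of_norm.hasSum

theorem norm_pow_div_poch_le_of_norm_le {b : ℂ} (hb : 1 ≤ b.re) {R : ℝ} {z : ℂ} (hz : ‖z‖ ≤ R)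
    (n : ℕ) : ‖z ^ n / poch b n‖ ≤ R ^ n / n.factorial :=
  (norm_pow_div_poch_le hb z n).trans (by gcongr)

theorem differentiable_kummer (hβ : 0 ≤ β.re) : Differentiable ℂ (kummer β) :=
  differentiable_tsum_of_norm_le_on_balls (fun n => by fun_prop) Real.summable_pow_div_factorial
    fun _ n _ hz => norm_pow_div_poch_le_of_norm_le (one_le_re_one_add hβ) hz n

theorem hasSum_natCast_mul_pow_div_poch (hβ : 0 ≤ β.re) (z : ℂ) :
    HasSum (fun n : ℕ => n * (z ^ n / poch (1 + β) n)) (z * deriv (kummer β) z) := by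
  have hderiv : HasSum (fun n : ℕ => deriv (fun x : ℂ => x ^ n / poch (1 + β) n) z)
      (deriv (kummer β) z) :=
    hasSum_deriv_of_summable_norm (U := Metric.ball 0 (‖z‖ + 1))
      (Real.summable_pow_div_factorial (‖z‖ + 1)) (fun n => by fun_prop) Metric.isOpen_ball
      (fun n x hx => norm_pow_div_poch_le_of_norm_le (one_le_re_one_add hβ)
        (mem_ball_zero_iff.mp hx).le n) (by simp)
  refine (hderiv.mul_left z).congr_fun fun n => ?_
  rw [deriv_div_const, deriv_pow_field]
  rcases n with _ | n
  · simp
  · rw [Nat.add_sub_cancel, pow_succ]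
    ring

theorem kummer_zero (hβ : 0 ≤ β.re) : kummer β 0 = 1 := by
  refine (hasSum_kummer hβ 0).unique ?_
  convert! hasSum_single (f := fun n : ℕ => (0 : ℂ) ^ n / poch (1 + β) n) 0 ?_ using 1
  · simp [poch_zero]
  · intro n hn
    simp [hn]

theorem mul_deriv_kummer (hβ : 0 ≤ β.re) (z : ℂ) :
    z * deriv (kummer β) z = (z - β) * kummer β z + β := by
  have hsum : HasSum (fun n : ℕ => (n + β) * (z ^ n / poch (1 + β) n))
      (z * deriv (kummer β) z + β * kummer β z) := by
    refine ((hasSum_natCast_mul_pow_div_poch hβ z).add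
      ((hasSum_kummer hβ z).mul_left β)).congr_fun fun n => ?_
    rw [add_mul]
  have hshift (n : ℕ) : ((n + 1 : ℕ) + β) * (z ^ (n + 1) / poch (1 + β) (n + 1)) =
      z * (z ^ n / poch (1 + β) n) := by
    have hsucc := poch_ne_zero (re_one_add_pos hβ) (n + 1)
    rw [poch_succ] at hsucc ⊢
    have hn := left_ne_zero_of_mul hsucc
    have hfactor := right_ne_zero_of_mul hsucc
    push_cast
    field_simp
    ring
  have h := ((hasSum_nat_add_iff' 1).mpr hsum).unique
    (((hasSum_kummer hβ z).mul_left z).congr_fun hshift)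
  simp only [Finset.range_one, Finset.sum_singleton, Nat.cast_zero, zero_add, pow_zero, poch_zero,
    div_one, mul_one] at h
  linear_combination h

/-! ### The even part of Kummer's function and its weighted tails -/

/-- The `k`-th term of the power series of `cosSeries`. -/
noncomputable def cosTerm (β z : ℂ) (k : ℕ) : ℂ := (-1) ^ k * z ^ (2 * k) / poch (1 + β) (2 * k)

/-- The even part of `z ↦ ₁F₁(1; 1 + β; iz)`, a one-parameter deformation of the cosine, which is
the case `β = 0`. -/
noncomputable def cosSeries (β z : ℂ) : ℂ := (kummer β (I * z) + kummer β (-I * z)) / 2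

theorem norm_cosTerm_le (hβ : 0 ≤ β.re) (z : ℂ) (k : ℕ) :
    ‖cosTerm β z k‖ ≤ ‖z‖ ^ (2 * k) / (2 * k).factorial := by
  have h := norm_pow_div_poch_le (one_le_re_one_add hβ) z (2 * k)
  rwa [cosTerm, mul_div_assoc, norm_mul, norm_pow, norm_neg, norm_one, one_pow, one_mul]

theorem summable_pow_two_mul_div_factorial (x : ℝ) :
    Summable fun k : ℕ => x ^ (2 * k) / (2 * k).factorial :=
  (Real.summable_pow_div_factorial x).comp_injective (mul_right_injective₀ two_ne_zero)

theorem summable_pow_two_mul_add_div_factorial (x : ℝ) (m : ℕ) :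
    Summable fun j : ℕ => x ^ (2 * (j + m)) / (2 * (j + m)).factorial :=
  (summable_nat_add_iff m).mpr (summable_pow_two_mul_div_factorial x)

theorem summable_norm_cosTerm (hβ : 0 ≤ β.re) (z : ℂ) : Summable fun k : ℕ => ‖cosTerm β z k‖ :=
  .of_nonneg_of_le (fun _ => norm_nonneg _) (norm_cosTerm_le hβ z)
    (summable_pow_two_mul_div_factorial _)

theorem hasSum_cosTerm (hβ : 0 ≤ β.re) (z : ℂ) : HasSum (cosTerm β z) (cosSeries β z) := by
  have hsum := ((hasSum_kummer hβ (I * z)).add (hasSum_kummer hβ (-I * z))).div_const 2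
  refine (((mul_right_injective₀ two_ne_zero).hasSum_iff fun n hn => ?_).mpr hsum).congr_fun
    fun k => ?_
  · have hodd : Odd n := by
      rcases Nat.even_or_odd' n with ⟨k, rfl | rfl⟩
      · exact absurd ⟨k, rfl⟩ hn
      · exact ⟨k, rfl⟩
    rw [neg_mul, hodd.neg_pow]
    ring
  · simp only [Function.comp, cosTerm, mul_pow, pow_mul, neg_sq, I_sq]
    ring

/-- The tail `∑_{k ≥ w + 1}` of the power series of `cosSeries β`. -/
noncomputable def cosTail (β : ℂ) (w : ℕ) (z : ℂ) : ℂ := ∑' j : ℕ, cosTerm β z (j + (w + 1))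

theorem hasSum_cosTail (hβ : 0 ≤ β.re) (w : ℕ) (z : ℂ) :
    HasSum (fun j => cosTerm β z (j + (w + 1))) (cosTail β w z) :=
  ((summable_nat_add_iff (w + 1)).mpr (summable_norm_cosTerm hβ z).of_norm).hasSum

theorem cosTail_eq_sub_sum (hβ : 0 ≤ β.re) (w : ℕ) (z : ℂ) :
    cosTail β w z = cosSeries β z - ∑ k ∈ Finset.range (w + 1), cosTerm β z k :=
  (hasSum_cosTail hβ w z).unique ((hasSum_nat_add_iff' (w + 1)).mpr (hasSum_cosTerm hβ z))

theorem cosTail_zero_eq (hβ : 0 ≤ β.re) (z : ℂ) : cosTail β 0 z = cosSeries β z - 1 := by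
  simp [cosTail_eq_sub_sum hβ, cosTerm, poch_zero]

theorem differentiable_cosSeries (hβ : 0 ≤ β.re) : Differentiable ℂ (cosSeries β) := by
  have h := differentiable_kummer hβ
  unfold cosSeries
  fun_prop

theorem differentiable_cosTail (hβ : 0 ≤ β.re) (w : ℕ) : Differentiable ℂ (cosTail β w) := by
  have hcos := differentiable_cosSeries hβ
  rw [funext (cosTail_eq_sub_sum hβ w)]
  unfold cosTerm
  fun_prop

theorem tsum_inv_factorial_two_mul_add_le (m : ℕ) :
    ∑' j : ℕ, (1 : ℝ) / (2 * (j + m)).factorial ≤ Real.exp 1 := by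
  have hexp : HasSum (fun n : ℕ => (1 : ℝ) / n.factorial) (Real.exp 1) := by
    simpa [Real.exp_eq_exp_ℝ] using NormedSpace.expSeries_div_hasSum_exp (1 : ℝ)
  have hinj : Function.Injective fun j : ℕ => 2 * (j + m) := fun a b h => by simpa using h
  rw [← hexp.tsum_eq]
  exact tsum_comp_le_tsum_of_inj hexp.summable (fun n => by positivity) hinj

theorem norm_tsum_le_exp_one_mul_pow {a : ℕ → ℂ} {x : ℝ} (hx0 : 0 ≤ x) (hx : x ≤ 1) (m : ℕ)
    (ha : ∀ j, ‖a j‖ ≤ x ^ (2 * (j + m)) / (2 * (j + m)).factorial) :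
    ‖∑' j, a j‖ ≤ Real.exp 1 * x ^ (2 * m) := by
  have hsum : Summable fun j : ℕ => 1 / ((2 * (j + m)).factorial : ℝ) := by
    simpa only [one_pow] using summable_pow_two_mul_add_div_factorial 1 m
  have hterm (j : ℕ) : ‖a j‖ ≤ 1 / (2 * (j + m)).factorial * x ^ (2 * m) := by
    refine (ha j).trans ?_
    rw [div_mul_eq_mul_div, one_mul]
    gcongr ?_ / _
    exact pow_le_pow_of_le_one hx0 hx (by lia)
  refine (tsum_of_norm_bounded (hsum.mul_right _).hasSum hterm).trans ?_
  rw [tsum_mul_right]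
  gcongr
  exact tsum_inv_factorial_two_mul_add_le m

theorem norm_cosTail_le (hβ : 0 ≤ β.re) (w : ℕ) {z : ℂ} (hz : ‖z‖ ≤ 1) :
    ‖cosTail β w z‖ ≤ Real.exp 1 * ‖z‖ ^ (2 * (w + 1)) :=
  norm_tsum_le_exp_one_mul_pow (norm_nonneg z) hz (w + 1) fun _ => norm_cosTerm_le hβ z _

/-- The `k`-th term of the series `primTail`. -/
noncomputable def primTerm (β z : ℂ) (k : ℕ) : ℂ := cosTerm β z k / (2 * k + β - 1 / 2)

/-- The series `∑_{k ≥ w + 1} (-1)ᵏ z²ᵏ / ((1 + β)₂ₖ (2k + β - 1/2))`, obtained from `cosTail β w`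
by integrating against `t ^ (β - 3/2)`; up to a constant it is `T_0(iz/π, β, 4w)`. -/
noncomputable def primTail (β : ℂ) (w : ℕ) (z : ℂ) : ℂ := ∑' j : ℕ, primTerm β z (j + (w + 1))

theorem one_le_norm_two_mul_add_sub_half (hβ : 0 ≤ β.re) {k : ℕ} (hk : 1 ≤ k) :
    1 ≤ ‖2 * (k : ℂ) + β - 1 / 2‖ := by
  have hk' : (1 : ℝ) ≤ k := by exact_mod_cast hk
  refine le_trans ?_ (re_le_norm _)
  simp only [sub_re, add_re, mul_re, re_ofNat, im_ofNat, natCast_re, natCast_im, div_ofNat_re,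
    one_re]
  linarith

theorem norm_primTerm_le (hβ : 0 ≤ β.re) (z : ℂ) {k : ℕ} (hk : 1 ≤ k) :
    ‖primTerm β z k‖ ≤ ‖z‖ ^ (2 * k) / (2 * k).factorial := by
  rw [primTerm, norm_div]
  exact (div_le_self (norm_nonneg _) (one_le_norm_two_mul_add_sub_half hβ hk)).trans
    (norm_cosTerm_le hβ z k)

theorem summable_norm_primTerm (hβ : 0 ≤ β.re) (w : ℕ) (z : ℂ) :
    Summable fun j : ℕ => ‖primTerm β z (j + (w + 1))‖ :=
  .of_nonneg_of_le (fun _ => norm_nonneg _) (fun j => norm_primTerm_le hβ z (by lia))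
    (summable_pow_two_mul_add_div_factorial _ _)

theorem norm_primTail_le (hβ : 0 ≤ β.re) (w : ℕ) {z : ℂ} (hz : ‖z‖ ≤ 1) :
    ‖primTail β w z‖ ≤ Real.exp 1 * ‖z‖ ^ (2 * (w + 1)) :=
  norm_tsum_le_exp_one_mul_pow (norm_nonneg z) hz (w + 1) fun _ => norm_primTerm_le hβ z (by lia)

theorem PTerm_eq_primTerm_mul (β z : ℂ) (k : ℕ) :
    PTerm z β k = primTerm β z k * (riemannZeta (2 * β + 4 * k))⁻¹ := by
  rw [PTerm, primTerm, cosTerm, div_div, ← div_eq_mul_inv, div_div]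

theorem TTerm_I_mul (β z : ℂ) (k : ℕ) : TTerm (I * z) β k = primTerm β (Real.pi * z) k := by
  have hpow : (Real.pi * (I * z)) ^ (2 * k) = (-1) ^ k * (Real.pi * z) ^ (2 * k) := by
    simp only [pow_mul, mul_pow, I_sq]
    ring
  rw [TTerm, primTerm, cosTerm, div_div, hpow]

/-! ### The Möbius expansion of `P` -/

/-- The coefficients `μ(n) / nˢ` of the Dirichlet series of `1 / ζ(s)`. -/
noncomputable def moebiusPow (s : ℂ) : ArithmeticFunction ℂ :=
  ⟨fun n => ((ArithmeticFunction.moebius n : ℤ) : ℂ) / (n : ℂ) ^ s, by simp⟩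

theorem moebiusPow_apply (s : ℂ) (n : ℕ) :
    moebiusPow s n = ((ArithmeticFunction.moebius n : ℤ) : ℂ) / (n : ℂ) ^ s := rfl

theorem norm_moebius_le_one (n : ℕ) : ‖((ArithmeticFunction.moebius n : ℤ) : ℂ)‖ ≤ 1 := by
  rw [norm_intCast]
  exact_mod_cast ArithmeticFunction.abs_moebius_le_one

theorem norm_moebiusPow_le (s : ℂ) {n : ℕ} (hn : 0 < n) : ‖moebiusPow s n‖ ≤ (n : ℝ) ^ (-s.re) := by
  rw [moebiusPow_apply, norm_div, norm_natCast_cpow_of_pos hn, Real.rpow_neg (by positivity),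
    ← one_div]
  gcongr
  exact norm_moebius_le_one n

theorem norm_moebiusPow_le_of_le_re {s : ℂ} {c : ℝ} (hs : c ≤ s.re) {n : ℕ} (hn : 0 < n) :
    ‖moebiusPow s n‖ ≤ (n : ℝ) ^ (-c) :=
  (norm_moebiusPow_le s hn).trans
    (Real.rpow_le_rpow_of_exponent_le (by exact_mod_cast hn) (by linarith))

theorem moebiusPow_add (s t : ℂ) {n : ℕ} (hn : n ≠ 0) :
    moebiusPow (s + t) n = moebiusPow s n / (n : ℂ) ^ t := by
  rw [moebiusPow_apply, moebiusPow_apply, cpow_add _ _ (by exact_mod_cast hn), div_div]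

theorem hasSum_moebiusPow {s : ℂ} (hs : 1 < s.re) :
    HasSum (fun n : ℕ+ => moebiusPow s n) (riemannZeta s)⁻¹ := by
  have hinv := LSeries_one_mul_Lseries_moebius hs
  have hsum := (ArithmeticFunction.LSeriesSummable_moebius_iff.mpr hs).LSeriesHasSum
  rw [LSeries_one_eq_riemannZeta hs] at hinv
  rw [eq_inv_of_mul_eq_one_right hinv, LSeriesHasSum] at hsum
  refine ((PNat.coe_injective.hasSum_iff fun n hn => ?_).mpr hsum).congr_fun fun n => ?_
  · have hn0 : n = 0 := by
      by_contra h0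
      exact hn ⟨⟨n, Nat.pos_of_ne_zero h0⟩, rfl⟩
    rw [hn0, LSeries.term_zero]
  · rw [Function.comp_apply, LSeries.term_of_ne_zero n.ne_zero, moebiusPow_apply]

theorem summable_pnat_rpow_neg {a : ℝ} (ha : 1 < a) :
    Summable fun n : ℕ+ => ((n : ℕ) : ℝ) ^ (-a) :=
  (Real.summable_nat_rpow.mpr (neg_lt_neg ha)).comp_injective PNat.coe_injective

theorem norm_inv_riemannZeta_le {s : ℂ} {c : ℝ} (hc : 1 < c) (hs : c ≤ s.re) :
    ‖(riemannZeta s)⁻¹‖ ≤ ∑' n : ℕ+, ((n : ℕ) : ℝ) ^ (-c) := by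
  rw [← (hasSum_moebiusPow (hc.trans_le hs)).tsum_eq]
  exact tsum_of_norm_bounded (summable_pnat_rpow_neg hc).hasSum
    fun n => norm_moebiusPow_le_of_le_re hs n.pos

section MoebiusExpansion

variable {ι : Type*} {a e : ι → ℂ} {c : ℝ}

theorem summable_norm_mul_moebiusPow (hc : 1 < c) (he : ∀ i, c ≤ (e i).re)
    (ha : Summable fun i => ‖a i‖) :
    Summable fun p : ℕ+ × ι => ‖a p.2 * moebiusPow (e p.2) p.1‖ := by
  refine .of_nonneg_of_le (fun _ => norm_nonneg _) (fun p => ?_)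
    ((summable_pnat_rpow_neg hc).mul_of_nonneg ha (fun n => by positivity) fun i => by positivity)
  rw [norm_mul, mul_comm]
  gcongr
  exact norm_moebiusPow_le_of_le_re (he p.2) p.1.pos

theorem summable_norm_tsum_mul_moebiusPow (hc : 1 < c) (he : ∀ i, c ≤ (e i).re)
    (ha : Summable fun i => ‖a i‖) :
    Summable fun n : ℕ+ => ‖∑' i, a i * moebiusPow (e i) n‖ := by
  have hdouble := summable_norm_mul_moebiusPow hc he ha
  exact .of_nonneg_of_le (fun _ => norm_nonneg _)
    (fun n => norm_tsum_le_tsum_norm (hdouble.prod_factor n)) hdouble.prod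

theorem tsum_tsum_mul_moebiusPow (hc : 1 < c) (he : ∀ i, c ≤ (e i).re)
    (ha : Summable fun i => ‖a i‖) :
    ∑' n : ℕ+, ∑' i, a i * moebiusPow (e i) n = ∑' i, a i * (riemannZeta (e i))⁻¹ := by
  have hcomm := Summable.tsum_comm (f := fun (n : ℕ+) (i : ι) => a i * moebiusPow (e i) n)
    (summable_norm_mul_moebiusPow hc he ha).of_norm
  rw [← hcomm]
  refine tsum_congr fun i => ?_
  rw [tsum_mul_left, (hasSum_moebiusPow (hc.trans_le (he i))).tsum_eq]

end MoebiusExpansion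

theorem two_le_re_two_mul_add (hβ : 0 ≤ β.re) {k : ℕ} (hk : 1 ≤ k) :
    2 ≤ (2 * β + 4 * (k : ℂ)).re := by
  have hk' : (1 : ℝ) ≤ k := by exact_mod_cast hk
  simp only [add_re, mul_re, re_ofNat, im_ofNat, natCast_re, natCast_im]
  linarith

theorem norm_PTerm_le (hβ : 0 ≤ β.re) (z : ℂ) {k : ℕ} (hk : 1 ≤ k) :
    ‖PTerm z β k‖ ≤ ‖z‖ ^ (2 * k) / (2 * k).factorial * ∑' n : ℕ+, ((n : ℕ) : ℝ) ^ (-2 : ℝ) := by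
  rw [PTerm_eq_primTerm_mul, norm_mul]
  gcongr
  · exact norm_primTerm_le hβ z hk
  · exact norm_inv_riemannZeta_le one_lt_two (two_le_re_two_mul_add hβ hk)

theorem summable_norm_PTerm (hβ : 0 ≤ β.re) (w : ℕ) (z : ℂ) :
    Summable fun j : ℕ => ‖PTerm z β (j + (w + 1))‖ :=
  .of_nonneg_of_le (fun _ => norm_nonneg _) (fun j => norm_PTerm_le hβ z (by lia))
    ((summable_pow_two_mul_add_div_factorial _ _).mul_right _)

theorem summable_norm_TTerm (hβ : 0 ≤ β.re) (w : ℕ) (z : ℂ) :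
    Summable fun j : ℕ => ‖TTerm z β (j + (w + 1))‖ := by
  have hz : z = I * (-I * z) := by
    rw [← mul_assoc, mul_neg, I_mul_I, neg_neg, one_mul]
  rw [hz]
  simpa only [TTerm_I_mul] using summable_norm_primTerm hβ w (Real.pi * (-I * z))

theorem differentiable_P (hβ : 0 ≤ β.re) (w : ℕ) : Differentiable ℂ fun z : ℂ => P w z β := by
  refine Differentiable.const_mul (differentiable_tsum_of_norm_le_on_balls
    (fun j => by unfold PTerm; fun_prop)
    (fun R => (summable_pow_two_mul_add_div_factorial R (w + 1)).mul_right
      (∑' n : ℕ+, ((n : ℕ) : ℝ) ^ (-2 : ℝ))) fun R j z hz => ?_) _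
  refine (norm_PTerm_le hβ z (by lia)).trans ?_
  gcongr

/-- The constant in front of the series defining `P` and `T0`. -/
noncomputable def prefactor (β : ℂ) (w : ℕ) : ℂ :=
  (-1) ^ (w + 1) / ((Real.pi : ℂ) ^ (1 - β) * Gamma (1 + β))

theorem P_eq_prefactor_mul (β z : ℂ) (w : ℕ) :
    P w z β = prefactor β w * ∑' j : ℕ, PTerm z β (j + (w + 1)) := rfl

theorem T0_I_mul (β z : ℂ) (w : ℕ) :
    T0 (I * z) β w = prefactor β w * primTail β w (Real.pi * z) := by
  simp only [T0, TTerm_I_mul, prefactor, primTail]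

theorem moebiusPow_mul_primTail_div_sq (β z : ℂ) (w : ℕ) (n : ℕ+) :
    moebiusPow (2 * β) n * primTail β w (z / n ^ 2) =
      ∑' j : ℕ, primTerm β z (j + (w + 1)) * moebiusPow (2 * β + 4 * (j + (w + 1) : ℕ)) n := by
  rw [primTail, ← tsum_mul_left]
  refine tsum_congr fun j => ?_
  have hpow (k : ℕ) : ((n : ℕ) : ℂ) ^ (4 * k : ℂ) = (((n : ℕ) : ℂ) ^ 2) ^ (2 * k) := by
    rw [← pow_mul, ← cpow_natCast]
    congr 1
    push_cast
    ring
  rw [moebiusPow_add _ _ n.ne_zero, hpow]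
  simp only [primTerm, cosTerm, div_pow]
  ring

theorem summable_norm_moebiusPow_mul_primTail (hβ : 0 ≤ β.re) (w : ℕ) (z : ℂ) :
    Summable fun n : ℕ+ => ‖moebiusPow (2 * β) n * primTail β w (z / n ^ 2)‖ := by
  simp only [moebiusPow_mul_primTail_div_sq]
  exact summable_norm_tsum_mul_moebiusPow one_lt_two
    (fun j => two_le_re_two_mul_add hβ (by lia)) (summable_norm_primTerm hβ w z)

theorem P_eq_tsum_moebiusPow_mul_primTail (hβ : 0 ≤ β.re) (w : ℕ) (z : ℂ) :
    P w z β =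
      prefactor β w * ∑' n : ℕ+, moebiusPow (2 * β) n * primTail β w (z / n ^ 2) := by
  simp only [moebiusPow_mul_primTail_div_sq, P_eq_prefactor_mul, PTerm_eq_primTerm_mul]
  rw [tsum_tsum_mul_moebiusPow one_lt_two (fun j => two_le_re_two_mul_add hβ (by lia))
    (summable_norm_primTerm hβ w z)]

theorem moebiusPow_mul_T0 (β z : ℂ) (w : ℕ) (n : ℕ+) :
    moebiusPow (2 * β) n * T0 (I * z / n ^ 2) β w =
      prefactor β w * (moebiusPow (2 * β) n * primTail β w (Real.pi * z / n ^ 2)) := by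
  rw [mul_div_assoc, T0_I_mul, ← mul_div_assoc]
  ring

theorem summable_norm_moebiusPow_mul_T0 (hβ : 0 ≤ β.re) (w : ℕ) (z : ℂ) :
    Summable fun n : ℕ+ => ‖moebiusPow (2 * β) n * T0 (I * z / n ^ 2) β w‖ := by
  simp only [moebiusPow_mul_T0, norm_mul (prefactor β w)]
  exact (summable_norm_moebiusPow_mul_primTail hβ w _).mul_left _

theorem P_pi_mul_eq_tsum_moebiusPow_mul_T0 (hβ : 0 ≤ β.re) (w : ℕ) (z : ℂ) :
    P w (Real.pi * z) β = ∑' n : ℕ+, moebiusPow (2 * β) n * T0 (I * z / n ^ 2) β w := by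
  simp only [moebiusPow_mul_T0, tsum_mul_left]
  exact P_eq_tsum_moebiusPow_mul_primTail hβ w _

/-! ### Kummer's function on the imaginary axis -/

theorem hasDerivAt_ofReal_cpow {u : ℝ} (hu : 0 < u) (a : ℂ) :
    HasDerivAt (fun t : ℝ => (t : ℂ) ^ a) (a * (u : ℂ) ^ (a - 1)) u := by
  simpa using ((hasDerivAt_id (u : ℂ)).cpow_const (c := a) (by simp [hu])).comp_ofReal

theorem hasDerivAt_exp_neg_mul_ofReal (c : ℂ) (u : ℝ) :
    HasDerivAt (fun t : ℝ => exp (-(c * t))) (-c * exp (-(c * u))) u := by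
  have h := ((hasDerivAt_id (u : ℂ)).const_mul c).fun_neg.cexp.comp_ofReal
  simp only [id, mul_one] at h
  convert! h using 1
  ring

theorem norm_exp_neg_mul_ofReal {c : ℂ} (hc : c.re = 0) (u : ℝ) : ‖exp (-(c * u))‖ = 1 := by
  simp [norm_exp, hc]

theorem norm_le_of_norm_deriv_le_rpow {E : Type*} [NormedAddCommGroup E] [NormedSpace ℝ E]
    {F F' : ℝ → E} {a K : ℝ} (ha : a ≠ 0) (hF : ∀ t, 1 ≤ t → HasDerivAt F (F' t) t)
    (hF' : ∀ t, 1 ≤ t → ‖F' t‖ ≤ K * t ^ (a - 1)) {u : ℝ} (hu : 1 ≤ u) :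
    ‖F u‖ ≤ ‖F 1‖ + K / a * (u ^ a - 1) := by
  have hbound (t : ℝ) (ht : 1 ≤ t) : HasDerivAt (fun t : ℝ => ‖F 1‖ + K / a * (t ^ a - 1))
      (K * t ^ (a - 1)) t := by
    have h := (((Real.hasDerivAt_rpow_const (p := a) (Or.inl (by linarith : t ≠ 0))).sub_const
      1).const_mul (K / a)).const_add ‖F 1‖
    convert! h using 1
    field_simp
  exact image_norm_le_of_norm_deriv_right_le_deriv_boundary' (a := 1) (b := u)
    (fun t ht => (hF t ht.1).continuousAt.continuousWithinAt)
    (fun t ht => (hF t ht.1).hasDerivWithinAt) (by simp)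
    (fun t ht => (hbound t ht.1).continuousAt.continuousWithinAt)
    (fun t ht => (hbound t ht.1).hasDerivWithinAt) (fun t ht => hF' t ht.1) ⟨hu, le_rfl⟩

theorem hasDerivAt_kummer_mul_ofReal (hβ : 0 ≤ β.re) (c : ℂ) (u : ℝ) :
    HasDerivAt (fun t : ℝ => kummer β (c * t)) (deriv (kummer β) (c * u) * c) u := by
  have hmul : HasDerivAt (fun z : ℂ => c * z) c (u : ℂ) := by
    simpa using (hasDerivAt_id (u : ℂ)).const_mul c
  exact ((differentiable_kummer hβ (c * u)).hasDerivAt.comp (u : ℂ) hmul).comp_ofReal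

theorem continuous_kummer_mul_ofReal (hβ : 0 ≤ β.re) (c : ℂ) :
    Continuous fun t : ℝ => kummer β (c * t) :=
  (differentiable_kummer hβ).continuous.comp (by fun_prop)

theorem ofReal_cpow_eq_cpow_sub_one_mul {u : ℝ} (hu : 0 < u) (a : ℂ) :
    (u : ℂ) ^ a = (u : ℂ) ^ (a - 1) * u := by
  have hu0 : (u : ℂ) ≠ 0 := by exact_mod_cast hu.ne'
  rw [cpow_sub _ _ hu0, cpow_one, div_mul_cancel₀ _ hu0]

/-- The product `t ^ β * exp (-ct) * ₁F₁(1; 1 + β; ct)`. For `Re β > 0` it equals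
`β ∫₀ᵗ u ^ (β - 1) exp (-cu) du`, an incomplete Gamma function. -/
noncomputable def kummerIncomplete (β c : ℂ) (t : ℝ) : ℂ :=
  (t : ℂ) ^ β * exp (-(c * t)) * kummer β (c * t)

theorem hasDerivAt_kummerIncomplete (hβ : 0 ≤ β.re) (c : ℂ) {u : ℝ} (hu : 0 < u) :
    HasDerivAt (kummerIncomplete β c) (β * (u : ℂ) ^ (β - 1) * exp (-(c * u))) u := by
  have h := ((hasDerivAt_ofReal_cpow hu β).fun_mul (hasDerivAt_exp_neg_mul_ofReal c u)).fun_mul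
    (hasDerivAt_kummer_mul_ofReal hβ c u)
  convert! h using 1
  rw [ofReal_cpow_eq_cpow_sub_one_mul hu β]
  linear_combination (-(u : ℂ) ^ (β - 1) * exp (-(c * u))) * mul_deriv_kummer hβ (c * u)

-- Adding `β / c * t ^ (β - 1) * exp (-ct)` cancels the leading term of the derivative of
-- `kummerIncomplete` (one integration by parts), leaving an integrable one.
theorem hasDerivAt_kummerIncomplete_add (hβ : 0 ≤ β.re) {c : ℂ} (hc0 : c ≠ 0) {t : ℝ} (ht : 0 < t) :
    HasDerivAt
      (fun t : ℝ => kummerIncomplete β c t + β / c * ((t : ℂ) ^ (β - 1) * exp (-(c * t))))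
      (β / c * (β - 1) * (t : ℂ) ^ (β - 1 - 1) * exp (-(c * t))) t := by
  have h := (hasDerivAt_kummerIncomplete hβ c ht).add
    (((hasDerivAt_ofReal_cpow ht (β - 1)).mul (hasDerivAt_exp_neg_mul_ofReal c t)).const_mul
      (β / c))
  convert! h using 1
  field_simp
  ring

section ImaginaryAxis

variable {c : ℂ} (hc : c.re = 0)

include hc

theorem norm_kummerIncomplete {u : ℝ} (hu : 0 < u) :
    ‖kummerIncomplete β c u‖ = u ^ β.re * ‖kummer β (c * u)‖ := by
  rw [kummerIncomplete, norm_mul, norm_mul, norm_exp_neg_mul_ofReal hc,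
    norm_cpow_eq_rpow_re_of_pos hu, mul_one]

theorem exists_norm_kummer_le_of_re_pos (hβ : 0 < β.re) :
    ∃ C, ∀ u : ℝ, 1 ≤ u → ‖kummer β (c * u)‖ ≤ C := by
  refine ⟨‖kummerIncomplete β c 1‖ + ‖β‖ / β.re, fun u hu => ?_⟩
  have hgrowth := norm_le_of_norm_deriv_le_rpow hβ.ne'
    (fun t ht => hasDerivAt_kummerIncomplete hβ.le c (by linarith)) (K := ‖β‖) (fun t ht => by
      rw [norm_mul, norm_mul, norm_exp_neg_mul_ofReal hc,
        norm_cpow_eq_rpow_re_of_pos (by linarith), mul_one, sub_re, one_re]) hu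
  rw [norm_kummerIncomplete hc (by linarith)] at hgrowth
  have hpow : 1 ≤ u ^ β.re := Real.one_le_rpow hu hβ.le
  have hratio : 0 ≤ ‖β‖ / β.re := by positivity
  refine le_of_mul_le_mul_left (a := u ^ β.re) ?_ (by linarith)
  nlinarith [norm_nonneg (kummerIncomplete β c 1)]

theorem exists_norm_kummerIncomplete_le (hβ : 0 ≤ β.re) (hβ1 : β.re < 1) (hc0 : c ≠ 0) :
    ∃ C, ∀ u : ℝ, 1 ≤ u → ‖kummerIncomplete β c u‖ ≤ C := by
  set R : ℝ → ℂ := fun t => β / c * ((t : ℂ) ^ (β - 1) * exp (-(c * t))) with hR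
  set K : ℝ := ‖β / c * (β - 1)‖
  refine ⟨‖kummerIncomplete β c 1 + R 1‖ + K / (1 - β.re) + ‖β / c‖, fun u hu => ?_⟩
  have hsum := norm_le_of_norm_deriv_le_rpow (a := β.re - 1) (K := K) (by linarith)
    (fun t ht => hasDerivAt_kummerIncomplete_add hβ hc0 (by linarith)) (fun t ht => by
      rw [norm_mul, norm_mul, norm_exp_neg_mul_ofReal hc,
        norm_cpow_eq_rpow_re_of_pos (by linarith), mul_one, sub_re, sub_re, one_re]) hu
  have hpow : u ^ (β.re - 1) ≤ 1 := Real.rpow_le_one_of_one_le_of_nonpos hu (by linarith)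
  have hpow0 : 0 ≤ u ^ (β.re - 1) := by positivity
  have hconst : K / (β.re - 1) * (u ^ (β.re - 1) - 1) ≤ K / (1 - β.re) := by
    rw [← neg_div_neg_eq, neg_sub, neg_div, neg_mul, ← mul_neg, neg_sub]
    exact mul_le_of_le_one_right (div_nonneg (norm_nonneg _) (by linarith)) (by linarith)
  have hRu : ‖R u‖ ≤ ‖β / c‖ := by
    rw [hR, norm_mul, norm_mul, norm_exp_neg_mul_ofReal hc,
      norm_cpow_eq_rpow_re_of_pos (by linarith), mul_one, sub_re, one_re]
    exact mul_le_of_le_one_right (norm_nonneg _) hpow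
  calc ‖kummerIncomplete β c u‖
      = ‖kummerIncomplete β c u + R u - R u‖ := by rw [add_sub_cancel_right]
    _ ≤ ‖kummerIncomplete β c u + R u‖ + ‖R u‖ := norm_sub_le _ _
    _ ≤ _ := by linarith

theorem exists_norm_kummer_le_rpow (hβ : 0 ≤ β.re) (hβ1 : β.re < 1) (hc0 : c ≠ 0) :
    ∃ C, ∀ u : ℝ, 1 ≤ u → ‖kummer β (c * u)‖ ≤ C * u ^ (-β.re) := by
  obtain ⟨C, hC⟩ := exists_norm_kummerIncomplete_le hc hβ hβ1 hc0
  refine ⟨C, fun u hu => ?_⟩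
  have hu0 : 0 < u := by linarith
  rw [Real.rpow_neg hu0.le, ← div_eq_mul_inv, le_div_iff₀ (by positivity), mul_comm,
    ← norm_kummerIncomplete hc hu0]
  exact hC u hu

theorem exists_norm_kummer_le (hβ : 0 ≤ β.re) :
    ∃ C, ∀ u : ℝ, 0 ≤ u → ‖kummer β (c * u)‖ ≤ C := by
  rcases eq_or_ne c 0 with rfl | hc0
  · exact ⟨1, fun u _ => by rw [zero_mul, kummer_zero hβ, norm_one]⟩
  obtain ⟨C, hC⟩ : ∃ C, ∀ u : ℝ, 1 ≤ u → ‖kummer β (c * u)‖ ≤ C := by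
    rcases hβ.lt_or_eq with h | h
    · exact exists_norm_kummer_le_of_re_pos hc h
    · obtain ⟨C, hC⟩ := exists_norm_kummer_le_rpow hc hβ (by linarith) hc0
      exact ⟨C, fun u hu => by simpa [← h] using hC u hu⟩
  obtain ⟨D, hD⟩ := (isCompact_Icc (a := (0 : ℝ)) (b := 1)).exists_bound_of_continuousOn
    (continuous_kummer_mul_ofReal hβ c).continuousOn
  refine ⟨max C D, fun u hu => ?_⟩
  rcases le_total 1 u with h | h
  · exact (hC u h).trans (le_max_left _ _)
  · exact (hD u ⟨hu, h⟩).trans (le_max_right _ _)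

end ImaginaryAxis

theorem neg_I_re : (-I).re = 0 := by rw [neg_re, I_re, neg_zero]

theorem exists_norm_cosSeries_le (hβ : 0 ≤ β.re) :
    ∃ C, ∀ u : ℝ, 0 ≤ u → ‖cosSeries β u‖ ≤ C := by
  obtain ⟨C, hC⟩ := exists_norm_kummer_le I_re hβ
  obtain ⟨D, hD⟩ := exists_norm_kummer_le neg_I_re hβ
  refine ⟨(C + D) / 2, fun u hu => ?_⟩
  rw [cosSeries, norm_div, norm_ofNat]
  gcongr
  exact norm_add_le_of_le (hC u hu) (hD u hu)

theorem exists_norm_cosSeries_le_rpow (hβ : 0 ≤ β.re) (hβ1 : β.re < 1) :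
    ∃ C, ∀ u : ℝ, 1 ≤ u → ‖cosSeries β u‖ ≤ C * u ^ (-β.re) := by
  obtain ⟨C, hC⟩ := exists_norm_kummer_le_rpow I_re hβ hβ1 I_ne_zero
  obtain ⟨D, hD⟩ := exists_norm_kummer_le_rpow neg_I_re hβ hβ1 (neg_ne_zero.mpr I_ne_zero)
  refine ⟨(C + D) / 2, fun u hu => ?_⟩
  rw [cosSeries, norm_div, norm_ofNat, div_mul_eq_mul_div, add_mul]
  gcongr
  exact norm_add_le_of_le (hC u hu) (hD u hu)

theorem exists_norm_cosTail_le (hβ : 0 ≤ β.re) (w : ℕ) :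
    ∃ C, ∀ u : ℝ, 1 ≤ u → ‖cosTail β w u‖ ≤ C * u ^ (2 * w) := by
  obtain ⟨C, hC⟩ := exists_norm_cosSeries_le hβ
  have hC0 : 0 ≤ C := (norm_nonneg _).trans (hC 0 le_rfl)
  refine ⟨C + (w + 1), fun u hu => ?_⟩
  have hu0 : 0 ≤ u := by linarith
  have hterm (k : ℕ) (hk : k ∈ Finset.range (w + 1)) : ‖cosTerm β u k‖ ≤ u ^ (2 * w) := by
    have hkw : k ≤ w := Finset.mem_range_succ_iff.mp hk
    refine (norm_cosTerm_le hβ u k).trans ?_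
    rw [norm_real, Real.norm_of_nonneg hu0]
    refine (div_le_self (by positivity) (by exact_mod_cast Nat.factorial_pos _)).trans ?_
    exact pow_le_pow_right₀ hu (by lia)
  rw [cosTail_eq_sub_sum hβ, add_mul]
  refine norm_sub_le_of_le ((hC u hu0).trans (le_mul_of_one_le_right hC0 (one_le_pow₀ hu))) ?_
  exact (norm_sum_le_of_le _ hterm).trans (by simp)

/-! ### Mellin transforms of convolutions and of dilation sums -/

theorem integral_norm_cpow_mul_comp_mul_left (G : ℝ → ℂ) (s : ℂ) {t : ℝ} (ht : 0 < t) :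
    ∫ x in Ioi (0 : ℝ), ‖(x : ℂ) ^ (s - 1) * G (t * x)‖ =
      t ^ (-s.re) * ∫ x in Ioi (0 : ℝ), ‖(x : ℂ) ^ (s - 1) * G x‖ := by
  have hdilate := integral_comp_mul_left_Ioi (fun x : ℝ => ‖(x : ℂ) ^ (s - 1) * G x‖) 0 ht
  have hpow : t ^ (-s.re) = t ^ (1 - s.re) * t⁻¹ := by
    rw [← Real.rpow_neg_one, ← Real.rpow_add ht]
    ring_nf
  rw [mul_zero, smul_eq_mul] at hdilate
  rw [hpow, mul_assoc, ← hdilate, ← integral_const_mul]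
  refine setIntegral_congr_fun measurableSet_Ioi fun x (hx : 0 < x) => ?_
  simp only [norm_mul]
  rw [norm_cpow_eq_rpow_re_of_pos hx, norm_cpow_eq_rpow_re_of_pos (mul_pos ht hx),
    Real.mul_rpow ht.le hx.le, ← mul_assoc, ← mul_assoc, ← Real.rpow_add ht, sub_re, one_re,
    sub_add_sub_cancel, sub_self, Real.rpow_zero, one_mul]

section Convolution

variable {φ G : ℝ → ℂ} {s : ℂ} (hφm : Measurable φ) (hGm : Measurable G)
  (hφ : MellinConvergent φ (1 - s)) (hG : MellinConvergent G s)

include hφm hGm hφ hG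

theorem integrable_mul_cpow_mul_comp_mul :
    Integrable (fun p : ℝ × ℝ => φ p.1 * ((p.2 : ℂ) ^ (s - 1) * G (p.1 * p.2)))
      ((volume.restrict (Ioi 0)).prod (volume.restrict (Ioi 0))) := by
  have hφ' : IntegrableOn (fun t : ℝ => φ t * (t : ℂ) ^ (-s)) (Ioi 0) := by
    refine hφ.congr (.of_forall fun t => ?_)
    simp only [smul_eq_mul, sub_sub_cancel_left, mul_comm]
  refine (integrable_prod_iff (Measurable.aestronglyMeasurable (by fun_prop))).mpr ⟨?_, ?_⟩
  · refine (ae_restrict_mem measurableSet_Ioi).mono fun t ht => ?_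
    exact Integrable.const_mul ((MellinConvergent.comp_mul_left ht).mpr hG) (φ t)
  · refine (hφ'.norm.mul_const (∫ x in Ioi (0 : ℝ), ‖(x : ℂ) ^ (s - 1) * G x‖)).congr ?_
    refine (ae_restrict_mem measurableSet_Ioi).mono fun t (ht : 0 < t) => ?_
    simp only [norm_mul (φ t)]
    rw [integral_const_mul, integral_norm_cpow_mul_comp_mul_left G s ht, ← mul_assoc,
      norm_cpow_eq_rpow_re_of_pos ht, neg_re]

theorem hasMellin_mul_convolution {F : ℝ → ℂ}
    (hF : ∀ x : ℝ, 0 < x → F x = ∫ t in Ioi (0 : ℝ), φ t * G (x * t)) :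
    HasMellin F s (mellin φ (1 - s) * mellin G s) := by
  set K : ℝ → ℝ → ℂ := fun t x => φ t * ((x : ℂ) ^ (s - 1) * G (t * x)) with hK
  have hKi := integrable_mul_cpow_mul_comp_mul hφm hGm hφ hG
  have hFK : ∀ x ∈ Ioi (0 : ℝ), (x : ℂ) ^ (s - 1) • F x = ∫ t in Ioi (0 : ℝ), K t x := by
    intro x hx
    rw [hF x hx, smul_eq_mul, ← integral_const_mul]
    refine integral_congr_ae (.of_forall fun t => ?_)
    simp only [hK, mul_comm x t]
    ring
  refine ⟨(integrableOn_congr_fun hFK measurableSet_Ioi).mpr hKi.integral_prod_right, ?_⟩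
  rw [mellin, setIntegral_congr_fun measurableSet_Ioi hFK,
    ← integral_integral_swap (f := K) hKi, mellin, ← integral_mul_const]
  refine setIntegral_congr_fun measurableSet_Ioi fun t ht => ?_
  have hdilate := mellin_comp_mul_left G s ht
  simp only [mellin, smul_eq_mul] at hdilate
  simp only [hK]
  rw [integral_const_mul, hdilate]
  simp only [mellin, smul_eq_mul, sub_sub_cancel_left]
  ring

end Convolution

theorem integrable_of_summable_integral_norm {α ι E : Type*} [Countable ι] [MeasurableSpace α]
    [NormedAddCommGroup E] {μ : Measure α} {F : ι → α → E} {G : α → E}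
    (hF : ∀ i, Integrable (F i) μ) (hs : Summable fun i => ∫ x, ‖F i x‖ ∂μ)
    (h : ∀ᵐ x ∂μ, HasSum (fun i => F i x) (G x)) : Integrable G μ := by
  refine ⟨aestronglyMeasurable_of_tendsto_ae atTop
    (fun t => (integrable_finsetSum t fun i _ => hF i).1) (h.mono fun x hx => ?_), ?_⟩
  · simpa only [Finset.sum_apply] using! hx
  calc ∫⁻ x, ‖G x‖ₑ ∂μ ≤ ∫⁻ x, ∑' i, ‖F i x‖ₑ ∂μ := by
        refine lintegral_mono_ae (h.mono fun x hx => ?_)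
        rw [← hx.tsum_eq]
        exact enorm_tsum_le_tsum_enorm
    _ = ENNReal.ofReal (∑' i, ∫ x, ‖F i x‖ ∂μ) := by
        rw [lintegral_tsum fun i => (hF i).1.enorm,
          ENNReal.ofReal_tsum_of_nonneg (fun i => integral_nonneg fun x => norm_nonneg _) hs]
        exact tsum_congr fun i => (ofReal_integral_norm_eq_lintegral_enorm (hF i)).symm
    _ < ⊤ := ENNReal.ofReal_lt_top

theorem hasMellin_of_hasSum_mul_comp_mul_left {ι : Type*} [Countable ι] {a : ι → ℂ} {r : ι → ℝ}
    {F G : ℝ → ℂ} {s : ℂ} (hr : ∀ i, 0 < r i) (ha : Summable fun i => ‖a i‖ * r i ^ (-s.re))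
    (hG : MellinConvergent G s)
    (hF : ∀ x : ℝ, 0 < x → HasSum (fun i => a i * G (r i * x)) (F x)) :
    HasMellin F s ((∑' i, a i * (r i : ℂ) ^ (-s)) * mellin G s) := by
  set T : ι → ℝ → ℂ := fun i x => a i * ((x : ℂ) ^ (s - 1) * G (r i * x)) with hT
  have hTint (i : ι) : IntegrableOn (T i) (Ioi 0) :=
    Integrable.const_mul ((MellinConvergent.comp_mul_left (hr i)).mpr hG) _
  have hTsum : Summable fun i => ∫ x in Ioi (0 : ℝ), ‖T i x‖ := by
    simp only [hT, norm_mul (a _), integral_const_mul]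
    simp only [integral_norm_cpow_mul_comp_mul_left G s (hr _), ← mul_assoc]
    exact ha.mul_right _
  have hTF : ∀ᵐ x ∂volume.restrict (Ioi (0 : ℝ)),
      HasSum (fun i => T i x) ((x : ℂ) ^ (s - 1) • F x) := by
    refine (ae_restrict_mem measurableSet_Ioi).mono fun x hx => ?_
    refine ((hF x hx).mul_left ((x : ℂ) ^ (s - 1))).congr_fun fun i => ?_
    simp only [hT]
    ring
  refine ⟨integrable_of_summable_integral_norm hTint hTsum hTF, ?_⟩
  rw [mellin, integral_congr_ae (hTF.mono fun x hx => hx.tsum_eq.symm),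
    ← integral_tsum_of_summable_integral_norm hTint hTsum, ← tsum_mul_right]
  refine tsum_congr fun i => ?_
  have hdilate := mellin_comp_mul_left G s (hr i)
  simp only [mellin, smul_eq_mul] at hdilate
  simp only [hT]
  rw [integral_const_mul, hdilate, ← mul_assoc]
  simp only [mellin, smul_eq_mul]

/-! ### Laplace transforms -/

/-- The weight `t ^ β * exp (-t)` of the Gamma integral `Γ(1 + β)`. -/
noncomputable def gammaWeight (β : ℂ) (t : ℝ) : ℂ := (t : ℂ) ^ β * exp (-t)

theorem measurable_gammaWeight (β : ℂ) : Measurable (gammaWeight β) := by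
  unfold gammaWeight
  fun_prop

theorem hasMellin_exp_neg {s : ℂ} (hs : 0 < s.re) :
    HasMellin (fun t : ℝ => exp (-t)) s (Gamma s) := by
  have hcomm (t : ℝ) : ((Real.exp (-t) : ℝ) : ℂ) * (t : ℂ) ^ (s - 1) =
      (t : ℂ) ^ (s - 1) • exp (-t) := by
    push_cast
    exact mul_comm _ _
  rw [Gamma_eq_integral hs, GammaIntegral]
  refine ⟨(GammaIntegral_convergent hs).congr (.of_forall hcomm), ?_⟩
  exact integral_congr_ae (.of_forall fun t => (hcomm t).symm)

theorem hasMellin_gammaWeight {s : ℂ} (hs : 0 < (s + β).re) :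
    HasMellin (gammaWeight β) s (Gamma (s + β)) :=
  ⟨MellinConvergent.cpow_smul.mpr (hasMellin_exp_neg hs).1,
    (mellin_cpow_smul _ _ _).trans (hasMellin_exp_neg hs).2⟩

theorem integrableOn_gammaWeight (hβ : 0 ≤ β.re) : IntegrableOn (gammaWeight β) (Ioi 0) := by
  simpa [MellinConvergent] using (hasMellin_gammaWeight (re_one_add_pos hβ)).1

theorem integral_gammaWeight (hβ : 0 ≤ β.re) :
    ∫ t in Ioi (0 : ℝ), gammaWeight β t = Gamma (1 + β) := by
  simpa [mellin] using (hasMellin_gammaWeight (re_one_add_pos hβ)).2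

theorem norm_gammaWeight {t : ℝ} (ht : 0 < t) (β : ℂ) :
    ‖gammaWeight β t‖ = t ^ β.re * Real.exp (-t) := by
  rw [gammaWeight, norm_mul, norm_cpow_eq_rpow_re_of_pos ht, norm_exp, neg_re, ofReal_re]

section LaplaceKummer

variable (hβ : 0 ≤ β.re)

include hβ

theorem hasDerivAt_gammaWeight_mul_kummer_sub_one (c : ℂ) {t : ℝ} (ht : 0 < t) :
    HasDerivAt (fun t => gammaWeight β t * (kummer β (c * t) - 1))
      (gammaWeight β t - (1 - c) * (gammaWeight β t * kummer β (c * t))) t := by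
  have hexp := hasDerivAt_exp_neg_mul_ofReal 1 t
  simp only [one_mul] at hexp
  have hprod := ((hasDerivAt_ofReal_cpow ht β).fun_mul hexp).fun_mul
    ((hasDerivAt_kummer_mul_ofReal hβ c t).sub_const 1)
  convert! hprod using 1
  rw [gammaWeight, ofReal_cpow_eq_cpow_sub_one_mul ht β]
  linear_combination (-(t : ℂ) ^ (β - 1) * exp (-t)) * mul_deriv_kummer hβ (c * t)

theorem continuousWithinAt_gammaWeight_mul_kummer_sub_one (c : ℂ) :
    ContinuousWithinAt (fun t => gammaWeight β t * (kummer β (c * t) - 1)) (Ici 0) 0 := by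
  have hlim : Tendsto (fun t : ℝ => ‖kummer β (c * t) - 1‖) (𝓝[>] 0) (𝓝 0) := by
    have hcont : Continuous fun t : ℝ => ‖kummer β (c * t) - 1‖ :=
      ((continuous_kummer_mul_ofReal hβ c).sub continuous_const).norm
    exact tendsto_nhdsWithin_of_tendsto_nhds (by simpa [kummer_zero hβ] using hcont.tendsto 0)
  refine continuousWithinAt_Ioi_iff_Ici.mp ?_
  rw [ContinuousWithinAt, ofReal_zero, mul_zero, kummer_zero hβ, sub_self, mul_zero]
  refine squeeze_zero_norm' ?_ hlim
  filter_upwards [Ioo_mem_nhdsGT one_pos] with t ht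
  rw [norm_mul, norm_gammaWeight ht.1]
  refine mul_le_of_le_one_left (norm_nonneg _) ?_
  exact mul_le_one₀ (Real.rpow_le_one ht.1.le ht.2.le hβ) (Real.exp_pos _).le
    (Real.exp_le_one_iff.mpr (neg_nonpos.mpr ht.1.le))

variable {c : ℂ} (hc : c.re = 0)

include hc

theorem tendsto_gammaWeight_mul_kummer_sub_one :
    Tendsto (fun t : ℝ => gammaWeight β t * (kummer β (c * t) - 1)) atTop (𝓝 0) := by
  obtain ⟨C, hC⟩ := exists_norm_kummer_le hc hβ
  have hlim := (tendsto_rpow_mul_exp_neg_mul_atTop_nhds_zero β.re 1 one_pos).mul_const (C + 1)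
  rw [zero_mul] at hlim
  refine squeeze_zero_norm' ?_ hlim
  filter_upwards [eventually_gt_atTop 0] with t ht
  rw [norm_mul, norm_gammaWeight ht, neg_one_mul]
  gcongr
  exact norm_sub_le_of_le (hC t ht.le) norm_one.le

theorem integrableOn_gammaWeight_mul_kummer :
    IntegrableOn (fun t : ℝ => gammaWeight β t * kummer β (c * t)) (Ioi 0) := by
  obtain ⟨C, hC⟩ := exists_norm_kummer_le hc hβ
  exact (integrableOn_gammaWeight hβ).mul_bdd (c := C)
    (continuous_kummer_mul_ofReal hβ c).aestronglyMeasurable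
    ((ae_restrict_mem measurableSet_Ioi).mono fun t ht => hC t (le_of_lt ht))

theorem one_sub_mul_integral_gammaWeight_mul_kummer :
    (1 - c) * ∫ t in Ioi (0 : ℝ), gammaWeight β t * kummer β (c * t) = Gamma (1 + β) := by
  have hint := integrableOn_gammaWeight_mul_kummer hβ hc
  have h := integral_Ioi_of_hasDerivAt_of_tendsto
    (continuousWithinAt_gammaWeight_mul_kummer_sub_one hβ c)
    (fun t ht => hasDerivAt_gammaWeight_mul_kummer_sub_one hβ c ht)
    ((integrableOn_gammaWeight hβ).sub (hint.const_mul (1 - c)))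
    (tendsto_gammaWeight_mul_kummer_sub_one hβ hc)
  rw [integral_sub (integrableOn_gammaWeight hβ) (hint.const_mul _), integral_const_mul,
    integral_gammaWeight hβ, ofReal_zero, mul_zero, kummer_zero hβ, sub_self, mul_zero,
    sub_zero] at h
  exact (sub_eq_zero.mp h).symm

end LaplaceKummer

theorem one_add_ofReal_sq_ne_zero (x : ℝ) : (1 + (x : ℂ) ^ 2) ≠ 0 := by
  have h : (1 + x ^ 2 : ℝ) ≠ 0 := by positivity
  exact_mod_cast h

theorem integrableOn_gammaWeight_mul_cosSeries (hβ : 0 ≤ β.re) (x : ℝ) :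
    IntegrableOn (fun t : ℝ => gammaWeight β t * cosSeries β (x * t)) (Ioi 0) := by
  refine (((integrableOn_gammaWeight_mul_kummer hβ (c := I * x) (by simp)).add
    (integrableOn_gammaWeight_mul_kummer hβ (c := -I * x) (by simp))).mul_const (1 / 2)).congr
    (.of_forall fun t => ?_)
  simp only [Pi.add_apply, cosSeries, mul_assoc]
  ring

theorem integral_gammaWeight_mul_cosSeries (hβ : 0 ≤ β.re) (x : ℝ) :
    ∫ t in Ioi (0 : ℝ), gammaWeight β t * cosSeries β (x * t) =
      Gamma (1 + β) / (1 + (x : ℂ) ^ 2) := by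
  have hre : (I * (x : ℂ)).re = 0 := by simp
  have hre' : (-I * (x : ℂ)).re = 0 := by simp
  have hsplit (t : ℝ) : gammaWeight β t * cosSeries β (x * t) =
      (gammaWeight β t * kummer β (I * x * t) + gammaWeight β t * kummer β (-I * x * t)) *
        (1 / 2) := by
    simp only [cosSeries, mul_assoc]
    ring
  simp only [hsplit]
  rw [integral_mul_const, integral_add (integrableOn_gammaWeight_mul_kummer hβ hre)
    (integrableOn_gammaWeight_mul_kummer hβ hre'), eq_div_iff (one_add_ofReal_sq_ne_zero x)]
  have hplus := one_sub_mul_integral_gammaWeight_mul_kummer hβ hre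
  have hminus := one_sub_mul_integral_gammaWeight_mul_kummer hβ hre'
  generalize (∫ t in Ioi (0 : ℝ), gammaWeight β t * kummer β (I * x * t)) = A at *
  generalize (∫ t in Ioi (0 : ℝ), gammaWeight β t * kummer β (-I * x * t)) = B at *
  linear_combination (1 + I * x) / 2 * hplus + (1 - I * x) / 2 * hminus +
    (A + B) * x ^ 2 / 2 * I_sq

theorem cosTerm_mul (β x t : ℂ) (k : ℕ) :
    cosTerm β (x * t) k = cosTerm β x k * t ^ (2 * k) := by
  simp only [cosTerm, mul_pow]
  ring

theorem gammaWeight_mul_cosTerm (β x : ℂ) (k : ℕ) {t : ℝ} (ht : 0 < t) :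
    gammaWeight β t * cosTerm β (x * t) k =
      cosTerm β x k * gammaWeight (β + (2 * k : ℕ)) t := by
  rw [gammaWeight, gammaWeight, cpow_add _ _ (by exact_mod_cast ht.ne'), cpow_natCast,
    cosTerm_mul]
  ring

theorem re_add_natCast_nonneg (hβ : 0 ≤ β.re) (n : ℕ) : 0 ≤ (β + n).re := by
  rw [add_re, natCast_re]
  positivity

theorem integrableOn_gammaWeight_mul_cosTerm (hβ : 0 ≤ β.re) (x : ℂ) (k : ℕ) :
    IntegrableOn (fun t : ℝ => gammaWeight β t * cosTerm β (x * t) k) (Ioi 0) :=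
  (integrableOn_congr_fun (fun _ ht => gammaWeight_mul_cosTerm β x k ht) measurableSet_Ioi).mpr
    ((integrableOn_gammaWeight (re_add_natCast_nonneg hβ _)).const_mul _)

theorem integral_gammaWeight_mul_cosTerm (hβ : 0 ≤ β.re) (x : ℂ) (k : ℕ) :
    ∫ t in Ioi (0 : ℝ), gammaWeight β t * cosTerm β (x * t) k =
      Gamma (1 + β) * (-x ^ 2) ^ k := by
  rw [setIntegral_congr_fun measurableSet_Ioi fun _ ht => gammaWeight_mul_cosTerm β x k ht,
    integral_const_mul, integral_gammaWeight (re_add_natCast_nonneg hβ _), ← add_assoc,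
    Gamma_add_natCast_eq_mul_poch (re_one_add_pos hβ), cosTerm, neg_pow (x ^ 2), ← pow_mul]
  field_simp [poch_ne_zero (re_one_add_pos hβ) (2 * k)]

theorem integral_gammaWeight_mul_cosTail (hβ : 0 ≤ β.re) (w : ℕ) (x : ℝ) :
    ∫ t in Ioi (0 : ℝ), gammaWeight β t * cosTail β w (x * t) =
      Gamma (1 + β) * ((-(x : ℂ) ^ 2) ^ (w + 1) / (1 + (x : ℂ) ^ 2)) := by
  have hterm (k : ℕ) := integrableOn_gammaWeight_mul_cosTerm hβ x k
  simp only [cosTail_eq_sub_sum hβ, mul_sub, Finset.mul_sum]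
  rw [integral_sub (integrableOn_gammaWeight_mul_cosSeries hβ x)
    (integrable_finsetSum _ fun k _ => hterm k), integral_finsetSum _ fun k _ => hterm k,
    integral_gammaWeight_mul_cosSeries hβ]
  simp only [integral_gammaWeight_mul_cosTerm hβ]
  rw [← Finset.mul_sum, mul_div_assoc', eq_div_iff (one_add_ofReal_sq_ne_zero x), sub_mul,
    div_mul_cancel₀ _ (one_add_ofReal_sq_ne_zero x)]
  linear_combination Gamma (1 + β) * geom_sum_mul (-(x : ℂ) ^ 2) (w + 1)

/-! ### The Mellin transforms of `cosTail`, `primTail` and `P` -/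

theorem hasMellin_inv_one_add {s : ℂ} (hs : s.re ∈ Ioo 0 1) :
    HasMellin (fun x : ℝ => (1 + (x : ℂ))⁻¹) s (Real.pi / sin (Real.pi * s)) := by
  have hexp := hasMellin_exp_neg hs.1
  have hexp' := hasMellin_exp_neg (s := 1 - s) (by simpa using hs.2)
  rw [← Gamma_mul_Gamma_one_sub, mul_comm, ← hexp.2, ← hexp'.2]
  refine hasMellin_mul_convolution (by fun_prop) (by fun_prop) hexp'.1 hexp.1 fun x hx => ?_
  have hint := integral_exp_mul_complex_Ioi (a := -(1 + (x : ℂ)))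
    (by simp only [neg_re, add_re, one_re, ofReal_re]; linarith) 0
  rw [ofReal_zero, mul_zero, exp_zero, neg_div_neg_eq, one_div] at hint
  rw [← hint]
  refine integral_congr_ae (.of_forall fun t => ?_)
  simp only [← exp_add]
  push_cast
  ring_nf

theorem mellin_inv_one_add_sq {s : ℂ} (hs : s.re ∈ Ioo 0 2) :
    mellin (fun x : ℝ => (1 + (x : ℂ) ^ 2)⁻¹) s = Real.pi / (2 * sin (Real.pi * s / 2)) := by
  have hhalf : (s / (2 : ℝ)).re ∈ Ioo 0 1 := by
    rw [div_ofReal_re]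
    exact ⟨by linarith [hs.1], by linarith [hs.2]⟩
  have hcomp := mellin_comp_rpow (fun x : ℝ => (1 + (x : ℂ))⁻¹) s 2
  simp only [Real.rpow_two, ofReal_pow] at hcomp
  rw [hcomp, (hasMellin_inv_one_add hhalf).2, abs_of_pos two_pos, real_smul, ofReal_inv,
    ofReal_ofNat, mul_div_assoc, ← div_eq_inv_mul, div_div, mul_comm (2 : ℂ) (sin _)]

section MellinStrip

variable {w : ℕ} {q : ℂ} (hq : q.re ∈ Ioo (2 * (w : ℝ)) (2 * (w + 1)))

include hq

theorem mellin_pow_div_one_add_sq :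
    mellin (fun x : ℝ => (-(x : ℂ) ^ 2) ^ (w + 1) / (1 + (x : ℂ) ^ 2)) (-q) =
      -(Real.pi / (2 * sin (Real.pi * q / 2))) := by
  have hre : (-q + (2 * (w + 1) : ℕ)).re ∈ Ioo 0 2 := by
    simp only [add_re, neg_re, natCast_re]
    push_cast
    exact ⟨by linarith [hq.2], by linarith [hq.1]⟩
  have hpow (x : ℝ) : (-(x : ℂ) ^ 2) ^ (w + 1) / (1 + (x : ℂ) ^ 2) =
      (-1 : ℂ) ^ (w + 1) • ((x : ℂ) ^ (((2 * (w + 1) : ℕ) : ℂ)) • (1 + (x : ℂ) ^ 2)⁻¹) := by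
    rw [cpow_natCast, neg_pow, pow_mul, smul_eq_mul, smul_eq_mul]
    ring
  have hsin : sin (Real.pi * (-q + (2 * (w + 1) : ℕ)) / 2) =
      (-1) ^ w * sin (Real.pi * q / 2) := by
    have harg : Real.pi * (-q + (2 * (w + 1) : ℕ)) / 2 =
        (Real.pi - Real.pi * q / 2) + w * Real.pi := by
      push_cast
      ring
    rw [harg, sin_antiperiodic.add_nat_mul_eq, sin_pi_sub]
  simp only [hpow]
  rw [mellin_const_smul, mellin_cpow_smul, mellin_inv_one_add_sq hre, hsin, smul_eq_mul]
  have hsign : ((-1 : ℂ) ^ w) * (-1) ^ w = 1 := by rw [← mul_pow]; simp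
  have hsign0 : ((-1 : ℂ) ^ w) ≠ 0 := left_ne_zero_of_mul_eq_one hsign
  rw [pow_succ, mul_left_comm (2 : ℂ), div_mul_eq_div_div_swap]
  field_simp

variable (hβ : 0 ≤ β.re)

include hβ

theorem mellinConvergent_cosTail : MellinConvergent (fun x : ℝ => cosTail β w x) (-q) := by
  obtain ⟨C, hC⟩ := exists_norm_cosTail_le hβ w
  refine mellinConvergent_of_isBigO_rpow (a := -(2 * w : ℕ)) (b := -(2 * (w + 1) : ℕ))
    ?_ ?_ (by simpa using hq.1) ?_ (by simpa using hq.2)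
  · exact ((differentiable_cosTail hβ w).continuous.comp
      continuous_ofReal).locallyIntegrable.locallyIntegrableOn _
  · refine .of_bound C ?_
    filter_upwards [eventually_ge_atTop 1] with u hu
    rw [neg_neg, Real.rpow_natCast, Real.norm_of_nonneg (by positivity)]
    exact hC u hu
  · refine .of_bound (Real.exp 1) ?_
    filter_upwards [Ioo_mem_nhdsGT one_pos] with u hu
    have hnorm : ‖(u : ℂ)‖ = u := by rw [norm_real, Real.norm_of_nonneg hu.1.le]
    rw [neg_neg, Real.rpow_natCast, Real.norm_of_nonneg (pow_nonneg hu.1.le _)]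
    simpa only [hnorm] using norm_cosTail_le hβ w (z := u) (hnorm.trans_le hu.2.le)

theorem mellin_cosTail :
    mellin (fun x : ℝ => cosTail β w x) (-q) =
      -(Real.pi * Gamma (1 + β) / (2 * sin (Real.pi * q / 2) * Gamma (1 + β + q))) := by
  have hre : 0 < (1 - -q + β).re := by
    simp only [sub_neg_eq_add, add_re, one_re]
    linarith [hq.1, (w.cast_nonneg : (0 : ℝ) ≤ w)]
  have hweight := hasMellin_gammaWeight hre
  have hmul := (hasMellin_mul_convolution (measurable_gammaWeight β)
    ((differentiable_cosTail hβ w).continuous.comp continuous_ofReal).measurable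
    hweight.1 (mellinConvergent_cosTail hq hβ)
    (F := fun x : ℝ => Gamma (1 + β) • ((-(x : ℂ) ^ 2) ^ (w + 1) / (1 + (x : ℂ) ^ 2)))
    fun x _ => by
      simpa only [Function.comp_apply, ofReal_mul, smul_eq_mul] using
        (integral_gammaWeight_mul_cosTail hβ w x).symm).2
  rw [mellin_const_smul, mellin_pow_div_one_add_sq hq, hweight.2, smul_eq_mul] at hmul
  have hGamma : Gamma (1 + β + q) ≠ 0 := by
    rw [show 1 + β + q = 1 - -q + β by ring]
    exact Gamma_ne_zero_of_re_pos hre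
  rw [show 1 - -q + β = 1 + β + q by ring] at hmul
  refine mul_left_cancel₀ hGamma (hmul.symm.trans ?_)
  rw [div_mul_eq_div_div _ _ (Gamma _)]
  field_simp

end MellinStrip

theorem cpow_mul_cosTerm_mul (β z : ℂ) (k : ℕ) {t : ℝ} (ht : 0 < t) :
    (t : ℂ) ^ (β - 3 / 2) * cosTerm β (z * t) k =
      cosTerm β z k * (t : ℂ) ^ (2 * (k : ℂ) + β - 3 / 2) := by
  have hexp : 2 * (k : ℂ) + β - 3 / 2 = (β - 3 / 2) + (2 * k : ℕ) := by
    push_cast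
    ring
  rw [cosTerm_mul, hexp, cpow_add _ _ (by exact_mod_cast ht.ne'), cpow_natCast]
  ring

section PrimTailIntegral

variable (hβ : 0 ≤ β.re)

include hβ

theorem half_le_re_two_mul_add {k : ℕ} (hk : 1 ≤ k) :
    1 / 2 ≤ (2 * (k : ℂ) + β - 3 / 2).re := by
  have hk' : (1 : ℝ) ≤ k := by exact_mod_cast hk
  simp
  linarith

theorem integral_cpow_mul_cosTerm (z : ℂ) {k : ℕ} (hk : 1 ≤ k) :
    ∫ t in Ioc (0 : ℝ) 1, (t : ℂ) ^ (β - 3 / 2) * cosTerm β (z * t) k = primTerm β z k := by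
  have hre := half_le_re_two_mul_add hβ hk
  have h0 : 2 * (k : ℂ) + β - 1 / 2 ≠ 0 :=
    norm_pos_iff.mp (one_pos.trans_le (one_le_norm_two_mul_add_sub_half hβ hk))
  rw [setIntegral_congr_fun measurableSet_Ioc fun t ht => cpow_mul_cosTerm_mul β z k ht.1,
    integral_const_mul, ← intervalIntegral.integral_of_le zero_le_one,
    integral_cpow (Or.inl (by linarith)),
    show 2 * (k : ℂ) + β - 3 / 2 + 1 = 2 * (k : ℂ) + β - 1 / 2 by ring, ofReal_one, ofReal_zero,
    one_cpow, zero_cpow h0, sub_zero, mul_one_div, primTerm]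

theorem norm_cpow_mul_cosTerm_le (z : ℂ) {k : ℕ} (hk : 1 ≤ k) {t : ℝ} (ht : t ∈ Ioc (0 : ℝ) 1) :
    ‖(t : ℂ) ^ (β - 3 / 2) * cosTerm β (z * t) k‖ ≤ ‖cosTerm β z k‖ := by
  rw [cpow_mul_cosTerm_mul β z k ht.1, norm_mul, norm_cpow_eq_rpow_re_of_pos ht.1]
  refine mul_le_of_le_one_right (norm_nonneg _) (Real.rpow_le_one ht.1.le ht.2 ?_)
  linarith [half_le_re_two_mul_add hβ hk]

theorem primTail_eq_integral (w : ℕ) (z : ℂ) :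
    primTail β w z = ∫ t in Ioc (0 : ℝ) 1, (t : ℂ) ^ (β - 3 / 2) * cosTail β w (z * t) := by
  have hmeas (k : ℕ) : Measurable fun t : ℝ => (t : ℂ) ^ (β - 3 / 2) * cosTerm β (z * t) k := by
    unfold cosTerm
    fun_prop
  have hsum : HasSum (fun j : ℕ => ∫ t in Ioc (0 : ℝ) 1,
      (t : ℂ) ^ (β - 3 / 2) * cosTerm β (z * t) (j + (w + 1)))
      (∫ t in Ioc (0 : ℝ) 1, (t : ℂ) ^ (β - 3 / 2) * cosTail β w (z * t)) := by
    have hbound : Summable fun j : ℕ => ‖cosTerm β z (j + (w + 1))‖ :=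
      (summable_norm_cosTerm hβ z).comp_injective (add_left_injective (w + 1))
    refine hasSum_integral_of_dominated_convergence
      (bound := fun j _ => ‖cosTerm β z (j + (w + 1))‖) (fun j => ?_) (fun j => ?_) ?_ ?_ ?_
    · exact (hmeas _).aestronglyMeasurable
    · exact (ae_restrict_mem measurableSet_Ioc).mono fun t ht =>
        norm_cpow_mul_cosTerm_le hβ z (by lia) ht
    · exact .of_forall fun _ => hbound
    · exact integrable_const _
    · exact .of_forall fun t => (hasSum_cosTail hβ w _).mul_left _
  rw [← hsum.tsum_eq, primTail]
  exact tsum_congr fun j => (integral_cpow_mul_cosTerm hβ z (by lia)).symm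

end PrimTailIntegral

section MellinP

variable {w : ℕ} {q : ℂ} (hq : q.re ∈ Ioo (2 * (w : ℝ)) (2 * (w + 1))) (hβ : 0 ≤ β.re)
  (hβq : 1 / 2 - β.re < q.re)

include hq hβ hβq

theorem hasMellin_primTail :
    HasMellin (fun x : ℝ => primTail β w x) (-q)
      (1 / (q + β - 1 / 2) * mellin (fun x : ℝ => cosTail β w x) (-q)) := by
  have hcpow := hasMellin_cpow_Ioc (β - 3 / 2) (s := 1 - -q) (by simp; linarith)
  have hexp : 1 - -q + (β - 3 / 2) = q + β - 1 / 2 := by ring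
  rw [← hexp, ← hcpow.2]
  refine hasMellin_mul_convolution (Measurable.indicator (by fun_prop) measurableSet_Ioc)
    ((differentiable_cosTail hβ w).continuous.comp continuous_ofReal).measurable hcpow.1
    (mellinConvergent_cosTail hq hβ) fun x _ => ?_
  have hindicator (t : ℝ) : (Ioc (0 : ℝ) 1).indicator (fun t : ℝ => (t : ℂ) ^ (β - 3 / 2)) t *
      cosTail β w (x * t : ℝ) = (Ioc (0 : ℝ) 1).indicator
        (fun t : ℝ => (t : ℂ) ^ (β - 3 / 2) * cosTail β w (x * t)) t := by
    rw [indicator_mul_left, ofReal_mul]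
  simp only [hindicator, Function.comp_apply]
  rw [setIntegral_indicator measurableSet_Ioc, inter_eq_right.mpr Ioc_subset_Ioi_self,
    primTail_eq_integral hβ]

theorem hasMellin_P :
    HasMellin (fun x : ℝ => P w x β) (-q) (prefactor β w * ((riemannZeta (2 * β + 2 * q))⁻¹ *
      mellin (fun x : ℝ => primTail β w x) (-q))) := by
  have hre : 1 < (2 * β + 2 * q).re := by
    simp
    linarith
  have hn0 (n : ℕ+) : (0 : ℝ) < (n : ℕ) := by exact_mod_cast n.pos
  have hcpow (n : ℕ+) : ((((n : ℝ) ^ 2)⁻¹ : ℝ) : ℂ) ^ (- -q) = ((n : ℂ) ^ (2 * q))⁻¹ := by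
    have hinv := inv_cpow_ofReal_nonneg (sq_nonneg (n : ℝ)) q
    have hsq := natCast_cpow_natCast_mul n 2 q
    push_cast at hinv hsq ⊢
    rw [neg_neg, hinv, hsq]
  have hcoeff (n : ℕ+) : moebiusPow (2 * β) n * ((((n : ℝ) ^ 2)⁻¹ : ℝ) : ℂ) ^ (- -q) =
      moebiusPow (2 * β + 2 * q) n := by
    rw [hcpow, moebiusPow_add _ _ n.ne_zero, div_eq_mul_inv]
  have hsummable : Summable fun n : ℕ+ =>
      ‖moebiusPow (2 * β) n‖ * (((n : ℝ) ^ 2)⁻¹) ^ (-(-q).re) := by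
    refine (hasSum_moebiusPow hre).summable.norm.congr fun n => ?_
    rw [← hcoeff, norm_mul, norm_cpow_eq_rpow_re_of_pos (by have := hn0 n; positivity), neg_re]
  have hsum (x : ℝ) : HasSum (fun n : ℕ+ =>
      moebiusPow (2 * β) n * primTail β w (((n : ℝ) ^ 2)⁻¹ * x : ℝ))
      (∑' n : ℕ+, moebiusPow (2 * β) n * primTail β w (x / n ^ 2)) := by
    refine (summable_norm_moebiusPow_mul_primTail hβ w x).of_norm.hasSum.congr_fun fun n => ?_
    push_cast
    rw [inv_mul_eq_div]
  have hmellin := hasMellin_of_hasSum_mul_comp_mul_left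
    (fun n : ℕ+ => inv_pos.mpr (pow_pos (hn0 n) 2)) hsummable
    (hasMellin_primTail hq hβ hβq).1 fun x _ => hsum x
  simp only [hcoeff, (hasSum_moebiusPow hre).tsum_eq] at hmellin
  simpa only [P_eq_tsum_moebiusPow_mul_primTail hβ, smul_eq_mul, hmellin.2] using
    hasMellin_const_smul hmellin.1 (prefactor β w)

end MellinP

/-! ### The integral representations of `f` -/

theorem ne_one_of_one_lt_re {s : ℂ} (hs : 1 < s.re) : s ≠ 1 := by
  rintro rfl
  simp at hs

theorem xi_ne_zero_of_one_lt_re {s : ℂ} (hs : 1 < s.re) : xi s ≠ 0 := by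
  have h1 := ne_one_of_one_lt_re hs
  have hpi : (Real.pi : ℂ) ^ (-s / 2) ≠ 0 := by simp [cpow_eq_zero_iff, Real.pi_ne_zero]
  have hGamma : Gamma (1 + s / 2) ≠ 0 :=
    Gamma_ne_zero_of_re_pos (by rw [add_re, one_re, div_ofNat_re]; linarith)
  rw [xi_eq s (by linarith) h1]
  exact mul_ne_zero (mul_ne_zero (by norm_num) (mul_ne_zero (mul_ne_zero hpi
    (mul_ne_zero two_ne_zero hGamma)) (sub_ne_zero.mpr h1))) (riemannZeta_ne_zero_of_one_lt_re hs)

theorem sin_pi_mul_div_four_ne_zero {w : ℕ} {s : ℂ}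
    (hs : s.re ∈ Ioo (4 * (w : ℝ)) (4 * (w + 1))) : sin (Real.pi * s / 4) ≠ 0 := by
  intro hsin
  obtain ⟨k, hk⟩ := sin_eq_zero_iff.mp hsin
  have hsk : s = 4 * k := by
    rw [div_eq_iff (by norm_num)] at hk
    refine mul_left_cancel₀ (ofReal_ne_zero.mpr Real.pi_ne_zero) ?_
    linear_combination hk
  have hre : s.re = 4 * k := by simp [hsk]
  have hlower : (w : ℤ) < k := by exact_mod_cast (by linarith [hs.1] : (w : ℝ) < k)
  have hupper : k < (w : ℤ) + 1 := by exact_mod_cast (by linarith [hs.2] : (k : ℝ) < w + 1)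
  lia

theorem f_eq {s : ℂ} (hs : 1 < (2 * β + s).re) :
    f s β = (Real.pi : ℂ) ^ (β + s / 2) / (2 * sin (Real.pi * s / 4) * Gamma (1 + β + s / 2) *
      (2 * β + s - 1) * riemannZeta (2 * β + s)) := by
  rw [f, xi_eq _ (by linarith) (ne_one_of_one_lt_re hs),
    show -(2 * β + s) / 2 = -(β + s / 2) by ring, cpow_neg,
    show 1 + (2 * β + s) / 2 = 1 + β + s / 2 by ring]
  field_simp

@[fun_prop]
theorem differentiable_xi : Differentiable ℂ xi := by
  have := differentiable_completedZeta₀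
  unfold xi
  fun_prop

theorem analyticOnNhd_f (w : ℕ) {a : ℝ} (ha : 4 * (w : ℝ) ≤ a) (hβa : 1 - 2 * β.re ≤ a) :
    AnalyticOnNhd ℂ (fun s : ℂ => f s β) {s : ℂ | a < s.re ∧ s.re < 4 * ((w : ℝ) + 1)} := by
  refine DifferentiableOn.analyticOnNhd (fun s hs => DifferentiableAt.differentiableWithinAt ?_)
    ((isOpen_lt continuous_const continuous_re).inter (isOpen_lt continuous_re continuous_const))
  have hre : 1 < (2 * β + s).re := by
    have := hs.1
    simp
    linarith
  exact (differentiableAt_const _).div (by fun_prop) (mul_ne_zero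
    (sin_pi_mul_div_four_ne_zero ⟨ha.trans_lt hs.1, hs.2⟩)
    (mul_ne_zero two_ne_zero (xi_ne_zero_of_one_lt_re hre)))

theorem hasMellin_comp_mul_inv_sq {F : ℝ → ℂ} {a : ℝ} {s m : ℂ} (ha : 0 < a)
    (hF : HasMellin F (-(s / 2)) m) :
    HasMellin (fun v => F (a * (v ^ 2)⁻¹)) s ((a : ℂ) ^ (s / 2) / 2 * m) := by
  have hexp : s / ((-2 : ℝ) : ℂ) = -(s / 2) := by
    push_cast
    ring
  have hpow : EqOn (fun v : ℝ => (v : ℂ) ^ (s - 1) • F (a * v ^ (-2 : ℝ)))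
      (fun v : ℝ => (v : ℂ) ^ (s - 1) • F (a * (v ^ 2)⁻¹)) (Ioi 0) := fun v hv => by
    simp only [Real.rpow_neg (le_of_lt hv), Real.rpow_two]
  constructor
  · refine (integrableOn_congr_fun hpow measurableSet_Ioi).mp ?_
    refine (MellinConvergent.comp_rpow (f := fun x => F (a * x)) (by norm_num)).mpr ?_
    rw [hexp]
    exact (MellinConvergent.comp_mul_left ha).mpr hF.1
  · have hmellin := mellin_comp_rpow (fun x => F (a * x)) s (-2)
    rw [hexp, mellin_comp_mul_left _ _ ha, hF.2, neg_neg, abs_neg, Nat.abs_ofNat] at hmellin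
    rw [mellin, ← setIntegral_congr_fun measurableSet_Ioi hpow]
    refine hmellin.trans ?_
    rw [real_smul, smul_eq_mul]
    push_cast
    ring

theorem integrable_and_eq_integral_of_hasMellin {F : ℝ → ℂ} {s m : ℂ} (hF : HasMellin F s m) :
    Integrable (fun y : ℝ => exp (s * y) * F (Real.exp y)) ∧
      m = ∫ y : ℝ, exp (s * y) * F (Real.exp y) := by
  have hderiv : ∀ y ∈ univ, HasDerivWithinAt Real.exp (Real.exp y) univ y :=
    fun y _ => (Real.hasDerivAt_exp y).hasDerivWithinAt
  have himage : Real.exp '' univ = Ioi 0 := by rw [image_univ, Real.range_exp]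
  have hintegrand (y : ℝ) : |Real.exp y| • ((Real.exp y : ℂ) ^ (s - 1) • F (Real.exp y)) =
      exp (s * y) * F (Real.exp y) := by
    have hexp : exp (y : ℂ) ≠ 0 := exp_ne_zero _
    rw [abs_of_pos (Real.exp_pos y), real_smul, smul_eq_mul, ofReal_exp, ← mul_assoc,
      cpow_sub _ _ hexp, cpow_one, mul_div_cancel₀ _ hexp, cpow_def_of_ne_zero hexp, ← ofReal_exp,
      ← ofReal_log (Real.exp_pos y).le, Real.log_exp, mul_comm s]
  have hintegrable := integrableOn_image_iff_integrableOn_abs_deriv_smul MeasurableSet.univ hderiv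
    Real.exp_injective.injOn (fun t : ℝ => (t : ℂ) ^ (s - 1) • F t)
  have hintegral := integral_image_eq_integral_abs_deriv_smul MeasurableSet.univ hderiv
    Real.exp_injective.injOn (fun t : ℝ => (t : ℂ) ^ (s - 1) • F t)
  simp only [hintegrand, himage, integrableOn_univ, Measure.restrict_univ] at hintegrable hintegral
  exact ⟨hintegrable.mp hF.1, by rw [← hintegral, ← hF.2, mellin]⟩

theorem pi_cpow_mul_prefactor_mul_eq_f {s : ℂ} (hβ : 0 ≤ β.re) (hβs : 1 - 2 * β.re < s.re) (w : ℕ) :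
    (Real.pi : ℂ) ^ (s / 2) / 2 * (prefactor β w * ((riemannZeta (2 * β + 2 * (s / 2)))⁻¹ *
      (1 / (s / 2 + β - 1 / 2) * -(Real.pi * Gamma (1 + β) /
        (2 * sin (Real.pi * (s / 2) / 2) * Gamma (1 + β + s / 2)))))) = (-1) ^ w * f s β := by
  have hre : 1 < (2 * β + s).re := by
    simp
    linarith
  have hpi : (Real.pi : ℂ) ≠ 0 := ofReal_ne_zero.mpr Real.pi_ne_zero
  have hGamma := Gamma_ne_zero_of_re_pos (re_one_add_pos hβ)
  have hzeta := riemannZeta_ne_zero_of_one_lt_re hre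
  have hone : 2 * β + s - 1 ≠ 0 := sub_ne_zero.mpr (ne_one_of_one_lt_re hre)
  have hpiβ : (Real.pi : ℂ) ^ β ≠ 0 := by simp [cpow_eq_zero_iff, Real.pi_ne_zero]
  rw [f_eq hre, show s / 2 + β - 1 / 2 = (2 * β + s - 1) / 2 by ring, mul_div_cancel₀ s two_ne_zero,
    show Real.pi * (s / 2) / 2 = Real.pi * s / 4 by ring, prefactor, cpow_sub _ _ hpi,
    cpow_one, cpow_add _ _ hpi, pow_succ]
  field_simp

section IntegralRepresentation

variable {w : ℕ} {s : ℂ} (hs : s.re ∈ Ioo (4 * (w : ℝ)) (4 * (w + 1))) (hβ : 0 ≤ β.re)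
  (hβs : 1 - 2 * β.re < s.re)

include hs hβ hβs

theorem hasMellin_P_pi_mul_inv_sq :
    HasMellin (fun v : ℝ => P w ((Real.pi * (v ^ 2)⁻¹ : ℝ) : ℂ) β) s ((-1) ^ w * f s β) := by
  have hq : (s / 2).re ∈ Ioo (2 * (w : ℝ)) (2 * (w + 1)) := by
    rw [div_ofNat_re]
    exact ⟨by linarith [hs.1], by linarith [hs.2]⟩
  have hβq : 1 / 2 - β.re < (s / 2).re := by
    rw [div_ofNat_re]
    linarith
  have hP := hasMellin_P hq hβ hβq
  rw [(hasMellin_primTail hq hβ hβq).2, mellin_cosTail hq hβ] at hP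
  rw [← pi_cpow_mul_prefactor_mul_eq_f hβ hβs]
  exact hasMellin_comp_mul_inv_sq Real.pi_pos hP

theorem integrableOn_and_f_eq_integral_P :
    IntegrableOn (fun v : ℝ => (v : ℂ) ^ (s - 1) * P w ((Real.pi * (v ^ 2)⁻¹ : ℝ) : ℂ) β) (Ioi 0) ∧
    (-1) ^ w * f s β =
      ∫ v in Ioi (0 : ℝ), (v : ℂ) ^ (s - 1) * P w ((Real.pi * (v ^ 2)⁻¹ : ℝ) : ℂ) β :=
  have hP := hasMellin_P_pi_mul_inv_sq hs hβ hβs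
  ⟨hP.1, hP.2.symm⟩

theorem integrable_and_f_eq_integral_exp_mul_P :
    Integrable (fun y : ℝ => exp (s * y) * P w ((Real.pi * Real.exp (-2 * y) : ℝ) : ℂ) β) ∧
    (-1) ^ w * f s β =
      ∫ y : ℝ, exp (s * y) * P w ((Real.pi * Real.exp (-2 * y) : ℝ) : ℂ) β := by
  have hexp (y : ℝ) : (Real.exp y ^ 2)⁻¹ = Real.exp (-2 * y) := by
    rw [← Real.exp_nat_mul, ← Real.exp_neg, neg_mul, Nat.cast_two]
  simpa only [hexp] using
    integrable_and_eq_integral_of_hasMellin (hasMellin_P_pi_mul_inv_sq hs hβ hβs)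

end IntegralRepresentation

/-! ### The coefficients for `β = 1 / 4` -/

theorem re_one_div_four : ((1 : ℂ) / 4).re = 1 / 4 := by rw [div_ofNat_re, one_re]

theorem re_one_div_four_nonneg : 0 ≤ ((1 : ℂ) / 4).re := by norm_num [re_one_div_four]

theorem PTerm_one_div_four_div (z : ℂ) (k : ℕ) :
    PTerm z (1 / 4) k / ((Real.pi : ℂ) ^ (1 - (1 / 4 : ℂ)) * Gamma (1 + 1 / 4)) =
      cTilde k * (-z ^ 2) ^ k := by
  have hGamma := Gamma_add_natCast_eq_mul_poch (re_one_add_pos re_one_div_four_nonneg) (2 * k)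
  rw [cTilde, PTerm, show 5 / 4 + 2 * (k : ℂ) = 1 + 1 / 4 + (2 * k : ℕ) by push_cast; ring, hGamma,
    show 2 * (1 / 4 : ℂ) + 4 * k = 1 / 2 + 4 * k by ring, neg_pow (z ^ 2), ← pow_mul,
    show 2 * (k : ℂ) + 1 / 4 - 1 / 2 = 2 * k - 1 / 4 by ring,
    show (1 : ℂ) - 1 / 4 = 3 / 4 by norm_num, div_div, div_mul_eq_mul_div, one_mul]
  congr 1
  ring

theorem P_one_div_four_eq_tsum_cTilde (w : ℕ) (z : ℂ) :
    P w z (1 / 4) = (-1) ^ (w + 1) * ∑' j : ℕ, cTilde (j + (w + 1)) * (-z ^ 2) ^ (j + (w + 1)) := by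
  simp only [← PTerm_one_div_four_div]
  rw [tsum_div_const, P]
  ring

theorem P_eq_P_zero_add_sum (hβ : 0 ≤ β.re) (w : ℕ) (z : ℂ) :
    P w z β = (-1) ^ w * (P 0 z β +
      (∑ k ∈ Finset.Icc 1 w, PTerm z β k) / ((Real.pi : ℂ) ^ (1 - β) * Gamma (1 + β))) := by
  have hsplit := (summable_norm_PTerm hβ 0 z).of_norm.sum_add_tsum_nat_add w
  have hfinite :
      ∑ j ∈ Finset.range w, PTerm z β (j + (0 + 1)) = ∑ k ∈ Finset.Icc 1 w, PTerm z β k := by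
    rw [Finset.range_eq_Ico, Finset.sum_Ico_add' (fun k => PTerm z β k) 0 w (0 + 1)]
    rfl
  have htail : ∑' j : ℕ, PTerm z β (j + w + (0 + 1)) = ∑' j : ℕ, PTerm z β (j + (w + 1)) :=
    tsum_congr fun j => by rw [zero_add, add_assoc]
  rw [htail, hfinite] at hsplit
  rw [P, P, ← hsplit]
  ring

theorem P_one_div_four_eq_P_zero_add (w : ℕ) (z : ℂ) :
    P w z (1 / 4) = (-1) ^ w * (P 0 z (1 / 4) +
      ∑ k ∈ Finset.Icc 1 w, cTilde k * (-z ^ 2) ^ k) := by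
  simp only [P_eq_P_zero_add_sum re_one_div_four_nonneg w z, Finset.sum_div, PTerm_one_div_four_div]

theorem P_zero_one_div_four_eq_tsum_poch (z : ℂ) :
    P 0 z (1 / 4) = (4 / ((Real.pi : ℂ) ^ (3 / 4 : ℂ) * Gamma (1 / 4))) *
      (-1 * ∑' j : ℕ, (-z ^ 2) ^ (j + 1) /
        (poch (5 / 4) (2 * (j + 1)) * (2 * ((j + 1 : ℕ) : ℂ) - 1 / 4) *
          riemannZeta (1 / 2 + 4 * ((j + 1 : ℕ) : ℂ)))) := by
  have hGamma : Gamma (1 + 1 / 4) = 1 / 4 * Gamma (1 / 4) := by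
    rw [add_comm, Gamma_add_one _ (by norm_num)]
  have hterm (j : ℕ) : PTerm z (1 / 4) (j + (0 + 1)) = (-z ^ 2) ^ (j + 1) /
      (poch (5 / 4) (2 * (j + 1)) * (2 * ((j + 1 : ℕ) : ℂ) - 1 / 4) *
        riemannZeta (1 / 2 + 4 * ((j + 1 : ℕ) : ℂ))) := by
    rw [zero_add, PTerm, show (1 : ℂ) + 1 / 4 = 5 / 4 by norm_num, neg_pow (z ^ 2), ← pow_mul,
      show 2 * (1 / 4 : ℂ) + 4 * ((j + 1 : ℕ) : ℂ) = 1 / 2 + 4 * ((j + 1 : ℕ) : ℂ) by ring,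
      show 2 * ((j + 1 : ℕ) : ℂ) + 1 / 4 - 1 / 2 = 2 * ((j + 1 : ℕ) : ℂ) - 1 / 4 by ring]
  simp only [P, hGamma, hterm]
  rw [show (1 : ℂ) - 1 / 4 = 3 / 4 by norm_num, zero_add, pow_one]
  field_simp

/-! ### Partial sums of the zeta series on the line `Re s = 1` -/

theorem tsum_inv_natCast_add_sq_le (N : ℕ) :
    ∑' i : ℕ, (((i + N + 1 : ℕ) : ℝ) ^ 2)⁻¹ ≤ 2 / (N + 1) := by
  refine Real.tsum_le_of_sum_range_le (fun i => by positivity) fun n =>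
    le_of_eq_of_le ?_ (sum_Ioo_inv_sq_le (α := ℝ) N (n + N + 1))
  have hIoo : Finset.Ioo N (n + N + 1) = Finset.Ico (0 + (N + 1)) (n + (N + 1)) := by
    ext i
    simp only [Finset.mem_Ioo, Finset.mem_Ico]
    lia
  rw [hIoo, ← Finset.sum_Ico_add' (fun i : ℕ => ((i : ℝ) ^ 2)⁻¹) 0 n (N + 1),
    ← Finset.range_eq_Ico]
  rfl

theorem summable_inv_natCast_add_sq (N : ℕ) :
    Summable fun i : ℕ => (((i + N + 1 : ℕ) : ℝ) ^ 2)⁻¹ :=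
  (Real.summable_nat_pow_inv.mpr one_lt_two).comp_injective (add_left_injective (N + 1))

theorem intervalIntegrable_cpow_of_pos (s : ℂ) {a b : ℝ} (ha : 0 < a) (hb : 0 < b) :
    IntervalIntegrable (fun u : ℝ => (u : ℂ) ^ s) volume a b :=
  intervalIntegral.intervalIntegrable_cpow (Or.inr (notMem_uIcc_of_lt ha hb))

theorem integral_cpow_neg_eq {s : ℂ} (hs : s ≠ 1) {a b : ℝ} (ha : 0 < a) (hb : 0 < b) :
    ∫ u in a..b, (u : ℂ) ^ (-s) = ((b : ℂ) ^ (1 - s) - (a : ℂ) ^ (1 - s)) / (1 - s) := by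
  rw [integral_cpow (Or.inr ⟨fun h => hs (neg_injective h), notMem_uIcc_of_lt ha hb⟩),
    neg_add_eq_sub]

theorem norm_cpow_neg_sub_cpow_neg_le {s : ℂ} (hs : 1 ≤ s.re) {a b : ℝ} (ha : 1 ≤ a)
    (hab : a ≤ b) : ‖(b : ℂ) ^ (-s) - (a : ℂ) ^ (-s)‖ ≤ ‖s‖ * (a ^ 2)⁻¹ * (b - a) := by
  have ha0 : 0 < a := one_pos.trans_le ha
  have hderiv : ∀ v ∈ Icc a b, HasDerivWithinAt (fun t : ℝ => (t : ℂ) ^ (-s))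
      (-s * (v : ℂ) ^ (-s - 1)) (Icc a b) v := fun v hv =>
    (hasDerivAt_ofReal_cpow (ha0.trans_le hv.1) (-s)).hasDerivWithinAt
  have hbound : ∀ v ∈ Icc a b, ‖-s * (v : ℂ) ^ (-s - 1)‖ ≤ ‖s‖ * (a ^ 2)⁻¹ := fun v hv => by
    have hv0 : 0 < v := ha0.trans_le hv.1
    rw [norm_mul, norm_neg, norm_cpow_eq_rpow_re_of_pos hv0]
    refine mul_le_mul_of_nonneg_left ?_ (norm_nonneg _)
    calc v ^ (-s - 1).re ≤ v ^ (-2 : ℝ) :=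
          Real.rpow_le_rpow_of_exponent_le (ha.trans hv.1) (by simp; linarith)
      _ = (v ^ 2)⁻¹ := by rw [Real.rpow_neg hv0.le, Real.rpow_two]
      _ ≤ (a ^ 2)⁻¹ := by
        have := hv.1
        gcongr
  simpa only [Real.norm_of_nonneg (sub_nonneg.mpr hab)] using
    (convex_Icc a b).norm_image_sub_le_of_norm_hasDerivWithin_le hderiv hbound
      (left_mem_Icc.mpr hab) (right_mem_Icc.mpr hab)

/-- The error `m⁻ˢ - ∫_m^(m+1) u⁻ˢ du` in comparing a term of the zeta series with the corresponding
integral. The errors are summable for `Re s ≥ 1`, where the zeta series itself may diverge. -/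
noncomputable def zetaDefect (s : ℂ) (m : ℕ) : ℂ :=
  (m : ℂ) ^ (-s) - ∫ u in (m : ℝ)..(m + 1 : ℕ), (u : ℂ) ^ (-s)

theorem norm_zetaDefect_le {s : ℂ} (hs : 1 ≤ s.re) {m : ℕ} (hm : 0 < m) :
    ‖zetaDefect s m‖ ≤ ‖s‖ * ((m : ℝ) ^ 2)⁻¹ := by
  have hm0 : (0 : ℝ) < m := by exact_mod_cast hm
  have hm1 : (1 : ℝ) ≤ m := by exact_mod_cast hm
  have hintegral : zetaDefect s m =
      -∫ u in (m : ℝ)..(m + 1 : ℕ), ((u : ℂ) ^ (-s) - ((m : ℝ) : ℂ) ^ (-s)) := by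
    rw [intervalIntegral.integral_sub (intervalIntegrable_cpow_of_pos _ hm0 (by positivity))
      (by simp), intervalIntegral.integral_const]
    simp [zetaDefect]
  rw [hintegral, norm_neg]
  refine (intervalIntegral.norm_integral_le_of_norm_le_const
    (C := ‖s‖ * ((m : ℝ) ^ 2)⁻¹) fun u hu => ?_).trans (by simp)
  rw [uIoc_of_le (by simp), Nat.cast_succ] at hu
  refine (norm_cpow_neg_sub_cpow_neg_le hs hm1 hu.1.le).trans
    (mul_le_of_le_one_right (by positivity) ?_)
  linarith [hu.2]

theorem summable_zetaDefect {s : ℂ} (hs : 1 ≤ s.re) :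
    Summable fun i : ℕ => zetaDefect s (i + 1) :=
  .of_norm_bounded ((summable_inv_natCast_add_sq 0).mul_left ‖s‖) fun i =>
    norm_zetaDefect_le hs i.succ_pos

theorem sum_cpow_neg_eq (s : ℂ) (N : ℕ) :
    ∑ m ∈ Finset.Ioc 0 N, (m : ℂ) ^ (-s) = ∑ i ∈ Finset.range N, zetaDefect s (i + 1) +
      ∫ u in (1 : ℝ)..(N + 1 : ℕ), (u : ℂ) ^ (-s) := by
  induction N with
  | zero => simp
  | succ N ih =>
    rw [Finset.sum_Ioc_succ_top (Nat.zero_le N), ih, Finset.sum_range_succ, zetaDefect,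
      ← intervalIntegral.integral_add_adjacent_intervals
        (intervalIntegrable_cpow_of_pos (-s) one_pos (by positivity : (0 : ℝ) < (N + 1 : ℕ)))
        (intervalIntegrable_cpow_of_pos (-s) (by positivity)
          (by positivity : (0 : ℝ) < (N + 1 + 1 : ℕ)))]
    ring

theorem norm_tsum_zetaDefect_add_le {s : ℂ} (hs : 1 ≤ s.re) (N : ℕ) :
    ‖∑' i : ℕ, zetaDefect s (i + N + 1)‖ ≤ ‖s‖ * (2 / (N + 1)) := by
  refine (tsum_of_norm_bounded ((summable_inv_natCast_add_sq N).mul_left ‖s‖).hasSum fun i =>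
    norm_zetaDefect_le hs (i + N).succ_pos).trans ?_
  rw [tsum_mul_left]
  exact mul_le_mul_of_nonneg_left (tsum_inv_natCast_add_sq_le N) (norm_nonneg _)

theorem norm_integral_cpow_neg_le {s : ℂ} (hs : s.re = 1) {a b : ℝ} (ha : 0 < a) (hab : a ≤ b) :
    ‖∫ u in a..b, (u : ℂ) ^ (-s)‖ ≤ (b - a) / a := by
  have hbound := intervalIntegral.norm_integral_le_of_norm_le_const (a := a) (b := b) (C := a⁻¹)
    (f := fun u : ℝ => (u : ℂ) ^ (-s)) fun u hu => ?_
  · rwa [abs_of_nonneg (sub_nonneg.mpr hab), inv_mul_eq_div] at hbound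
  · rw [uIoc_of_le hab] at hu
    rw [norm_cpow_eq_rpow_re_of_pos (ha.trans hu.1), neg_re, hs, Real.rpow_neg_one]
    exact inv_anti₀ ha hu.1.le

theorem norm_sum_cpow_neg_sub_le {s : ℂ} (hs : s.re = 1) {y : ℝ} (hy : 1 ≤ y) :
    ‖∑ m ∈ Finset.Ioc 0 ⌊y⌋₊, (m : ℂ) ^ (-s) -
      (∑' i : ℕ, zetaDefect s (i + 1) + ∫ u in (1 : ℝ)..y, (u : ℂ) ^ (-s))‖ ≤
      (2 * ‖s‖ + 1) / y := by
  set N := ⌊y⌋₊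
  have hy0 : 0 < y := one_pos.trans_le hy
  have hyN : y ≤ N + 1 := (Nat.lt_floor_add_one y).le
  have hNy : (N + 1 : ℕ) - y ≤ 1 := by
    push_cast
    linarith [Nat.floor_le hy0.le]
  have hsplit := intervalIntegral.integral_add_adjacent_intervals
    (intervalIntegrable_cpow_of_pos (-s) one_pos hy0)
    (intervalIntegrable_cpow_of_pos (-s) hy0 (by positivity : (0 : ℝ) < (N + 1 : ℕ)))
  rw [sum_cpow_neg_eq, ← (summable_zetaDefect hs.ge).sum_add_tsum_nat_add N, ← hsplit]
  calc _ = ‖(∫ u in y..(N + 1 : ℕ), (u : ℂ) ^ (-s)) - ∑' i : ℕ, zetaDefect s (i + N + 1)‖ := by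
        congr 1
        ring
    _ ≤ ((N + 1 : ℕ) - y) / y + ‖s‖ * (2 / (N + 1)) :=
      (norm_sub_le _ _).trans (add_le_add
        (norm_integral_cpow_neg_le hs hy0 (by push_cast; exact hyN))
        (norm_tsum_zetaDefect_add_le hs.ge N))
    _ ≤ 1 / y + ‖s‖ * (2 / y) := by gcongr
    _ = (2 * ‖s‖ + 1) / y := by ring

theorem tendsto_sum_cpow_neg {s : ℂ} (hs : 1 < s.re) :
    Tendsto (fun N : ℕ => ∑ m ∈ Finset.Ioc 0 N, (m : ℂ) ^ (-s)) atTop (𝓝 (riemannZeta s)) := by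
  have hsum := LSeriesSummable.LSeriesHasSum (LSeriesSummable_one_iff.mpr hs)
  rw [LSeries_one_eq_riemannZeta hs] at hsum
  refine (hsum.tendsto_sum_nat.comp (tendsto_add_atTop_nat 1)).congr fun N => ?_
  rw [Function.comp, Finset.sum_range_succ', LSeries.term_zero, add_zero,
    Finset.range_eq_Ico, Finset.sum_Ico_add' (fun k => LSeries.term 1 s k) 0 N 1]
  refine Finset.sum_congr (by ext; simp; lia) fun m hm => ?_
  rw [LSeries.term_of_ne_zero (Finset.mem_Ioc.mp hm).1.ne', cpow_neg, Pi.one_apply, one_div]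

theorem tendsto_integral_cpow_neg {s : ℂ} (hs : 1 < s.re) :
    Tendsto (fun N : ℕ => ∫ u in (1 : ℝ)..(N + 1 : ℕ), (u : ℂ) ^ (-s)) atTop
      (𝓝 (-(1 / (1 - s)))) := by
  have hpow : Tendsto (fun N : ℕ => ((((N + 1 : ℕ) : ℝ)) : ℂ) ^ (1 - s)) atTop (𝓝 0) := by
    rw [tendsto_zero_iff_norm_tendsto_zero]
    refine (((tendsto_rpow_neg_atTop (y := s.re - 1) (by linarith)).comp
      tendsto_natCast_atTop_atTop).comp (tendsto_add_atTop_nat 1)).congr fun N => ?_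
    rw [norm_cpow_eq_rpow_re_of_pos (by positivity)]
    simp
  rw [show -(1 / (1 - s)) = (0 - 1) / (1 - s) by ring]
  refine ((hpow.sub_const 1).div_const (1 - s)).congr fun N => ?_
  rw [integral_cpow_neg_eq (ne_one_of_one_lt_re hs) one_pos (by positivity), ofReal_one, one_cpow]

theorem tsum_zetaDefect_of_one_lt_re {s : ℂ} (hs : 1 < s.re) :
    ∑' i : ℕ, zetaDefect s (i + 1) = riemannZeta s + 1 / (1 - s) := by
  have hlim := (tendsto_sum_cpow_neg hs).sub (tendsto_integral_cpow_neg hs)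
  rw [sub_neg_eq_add] at hlim
  refine tendsto_nhds_unique (summable_zetaDefect hs.le).hasSum.tendsto_sum_nat
    (hlim.congr fun N => ?_)
  rw [sum_cpow_neg_eq, add_sub_cancel_right]

theorem continuousAt_zetaDefect {s : ℂ} (hs : s ≠ 1) {m : ℕ} (hm : 0 < m) :
    ContinuousAt (fun s => zetaDefect s m) s := by
  have hm0 : (m : ℂ) ≠ 0 := by exact_mod_cast hm.ne'
  have hm1 : ((m + 1 : ℕ) : ℂ) ≠ 0 := by exact_mod_cast m.succ_ne_zero
  have hclosed (t : ℂ) (ht : t ≠ 1) : (m : ℂ) ^ (-t) -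
      (((m + 1 : ℕ) : ℂ) ^ (1 - t) - (m : ℂ) ^ (1 - t)) / (1 - t) = zetaDefect t m := by
    rw [zetaDefect, integral_cpow_neg_eq ht (by exact_mod_cast hm) (by positivity), ofReal_natCast,
      ofReal_natCast]
  have hsub : ContinuousAt (fun t : ℂ => 1 - t) s := by fun_prop
  refine ContinuousAt.congr (ContinuousAt.sub ?_ (ContinuousAt.div (ContinuousAt.sub ?_ ?_) hsub
    (sub_ne_zero.mpr hs.symm))) (mem_of_superset (isOpen_ne.mem_nhds hs) hclosed)
  · exact continuous_neg.continuousAt.const_cpow (Or.inl hm0)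
  · exact hsub.const_cpow (Or.inl hm1)
  · exact hsub.const_cpow (Or.inl hm0)

theorem tsum_zetaDefect_of_re_eq_one {s : ℂ} (hs : s.re = 1) (hs1 : s ≠ 1) :
    ∑' i : ℕ, zetaDefect s (i + 1) = riemannZeta s + 1 / (1 - s) := by
  have hlim : Tendsto (fun δ : ℝ => s + δ) (𝓝[>] 0) (𝓝 s) := by
    have hcont : Continuous fun δ : ℝ => s + δ := by fun_prop
    simpa only [ofReal_zero, add_zero] using (hcont.tendsto 0).mono_left nhdsWithin_le_nhds
  have hdefect : Tendsto (fun δ : ℝ => ∑' i : ℕ, zetaDefect (s + δ) (i + 1)) (𝓝[>] 0)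
      (𝓝 (∑' i : ℕ, zetaDefect s (i + 1))) := by
    refine tendsto_tsum_of_dominated_convergence
      ((summable_inv_natCast_add_sq 0).mul_left (‖s‖ + 1))
      (fun i => (continuousAt_zetaDefect hs1 i.succ_pos).tendsto.comp hlim) ?_
    filter_upwards [Ioo_mem_nhdsGT one_pos] with δ hδ i
    refine (norm_zetaDefect_le (by simp [hs, hδ.1.le]) i.succ_pos).trans
      (mul_le_mul_of_nonneg_right ((norm_add_le _ _).trans ?_) (by positivity))
    rw [norm_real, Real.norm_of_nonneg hδ.1.le]
    exact add_le_add le_rfl hδ.2.le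
  have hzeta : ContinuousAt (fun t : ℂ => riemannZeta t + 1 / (1 - t)) s :=
    (differentiableAt_riemannZeta hs1).continuousAt.add
      (continuousAt_const.div (by fun_prop) (sub_ne_zero.mpr hs1.symm))
  refine tendsto_nhds_unique (hdefect.congr' ?_) (hzeta.tendsto.comp hlim)
  filter_upwards [self_mem_nhdsWithin] with δ hδ
  exact tsum_zetaDefect_of_one_lt_re (by simpa [hs] using hδ)

/-! ### Bounded Möbius sums on the line `Re s = 1` -/

/-- The coefficients `n⁻ˢ` of the Dirichlet series of `ζ(s)`, the Dirichlet inverse of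
`moebiusPow s`; the value at `0` has to be set separately because `0 ^ 0 = 1`. -/
noncomputable def zetaPow (s : ℂ) : ArithmeticFunction ℂ :=
  ⟨fun n => if n = 0 then 0 else (n : ℂ) ^ (-s), if_pos rfl⟩

theorem zetaPow_apply (s : ℂ) {n : ℕ} (hn : n ≠ 0) : zetaPow s n = (n : ℂ) ^ (-s) := if_neg hn

theorem moebiusPow_mul_zetaPow (s : ℂ) : moebiusPow s * zetaPow s = 1 := by
  ext k
  have hterm : ∀ p ∈ k.divisorsAntidiagonal, moebiusPow s p.1 * zetaPow s p.2 =
      (k : ℂ) ^ (-s) * (((ArithmeticFunction.moebius : ArithmeticFunction ℂ) p.1) *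
        ((ArithmeticFunction.zeta : ArithmeticFunction ℂ) p.2)) := fun p hp => by
    obtain ⟨hprod, hk⟩ := Nat.mem_divisorsAntidiagonal.mp hp
    have hp2 : p.2 ≠ 0 := right_ne_zero_of_mul (hprod.trans_ne hk)
    rw [moebiusPow_apply, zetaPow_apply s hp2, ← hprod, Nat.cast_mul, natCast_mul_natCast_cpow,
      cpow_neg (p.1 : ℂ), div_eq_mul_inv]
    simp only [ArithmeticFunction.intCoe_apply, ArithmeticFunction.natCoe_apply,
      ArithmeticFunction.zeta_apply_ne hp2, Nat.cast_one]
    ring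
  rw [ArithmeticFunction.mul_apply, Finset.sum_congr rfl hterm, ← Finset.mul_sum,
    ← ArithmeticFunction.mul_apply, ArithmeticFunction.coe_moebius_mul_coe_zeta]
  rcases eq_or_ne k 1 with rfl | hk
  · simp
  · simp [ArithmeticFunction.one_apply_ne hk]

theorem sum_Ioc_one_arithmeticFunction {N : ℕ} (hN : 1 ≤ N) :
    ∑ n ∈ Finset.Ioc 0 N, (1 : ArithmeticFunction ℂ) n = 1 := by
  rw [Finset.sum_eq_single_of_mem 1 (Finset.mem_Ioc.mpr ⟨one_pos, hN⟩)
    fun n _ hn => ArithmeticFunction.one_apply_ne hn, ArithmeticFunction.one_one]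

theorem sum_moebiusPow_mul_sum_cpow_neg (s : ℂ) {N : ℕ} (hN : 1 ≤ N) :
    ∑ n ∈ Finset.Ioc 0 N, moebiusPow s n * ∑ m ∈ Finset.Ioc 0 (N / n), (m : ℂ) ^ (-s) = 1 := by
  rw [← sum_Ioc_one_arithmeticFunction hN, ← moebiusPow_mul_zetaPow s,
    ArithmeticFunction.sum_Ioc_mul_eq_sum_sum]
  refine Finset.sum_congr rfl fun n _ => congrArg _ (Finset.sum_congr rfl fun m hm => ?_)
  rw [zetaPow_apply s (Finset.mem_Ioc.mp hm).1.ne']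

theorem sum_moebius_mul_natCast_div {N : ℕ} (hN : 1 ≤ N) :
    ∑ n ∈ Finset.Ioc 0 N, ((ArithmeticFunction.moebius n : ℤ) : ℂ) * ((N / n : ℕ) : ℂ) = 1 := by
  rw [← sum_Ioc_one_arithmeticFunction hN, ← ArithmeticFunction.coe_moebius_mul_coe_zeta,
    ArithmeticFunction.sum_Ioc_mul_zeta_eq_sum]
  rfl

/-- Replacing `⌊N / n⌋` by `N / n` in `∑ μ(n) ⌊N / n⌋ = 1` costs at most `1` per term. -/
theorem norm_sum_moebiusPow_one_le (N : ℕ) : ‖∑ n ∈ Finset.Ioc 0 N, moebiusPow 1 n‖ ≤ 2 := by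
  rcases N.eq_zero_or_pos with rfl | hN
  · simp
  have hN0 : (0 : ℝ) < N := by exact_mod_cast hN
  have hN1 : (1 : ℝ) ≤ N := by exact_mod_cast hN
  have hsplit : (N : ℂ) * ∑ n ∈ Finset.Ioc 0 N, moebiusPow 1 n = 1 + ∑ n ∈ Finset.Ioc 0 N,
      ((ArithmeticFunction.moebius n : ℤ) : ℂ) * (((N : ℝ) / n - ((N / n : ℕ) : ℝ) : ℝ) : ℂ) := by
    refine Eq.trans ?_ (congrArg (· + _) (sum_moebius_mul_natCast_div hN))
    rw [← Finset.sum_add_distrib, Finset.mul_sum]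
    refine Finset.sum_congr rfl fun n _ => ?_
    rw [moebiusPow_apply, cpow_one]
    push_cast
    ring
  have hfract : ‖∑ n ∈ Finset.Ioc 0 N, ((ArithmeticFunction.moebius n : ℤ) : ℂ) *
      (((N : ℝ) / n - ((N / n : ℕ) : ℝ) : ℝ) : ℂ)‖ ≤ N := by
    refine (norm_sum_le_of_le _ (n := fun _ => (1 : ℝ)) fun n _ => ?_).trans (by simp)
    rw [norm_mul, norm_real, ← Nat.floor_div_eq_div (K := ℝ)]
    have hfloor : ((⌊(N : ℝ) / n⌋₊ : ℕ) : ℝ) ≤ N / n := Nat.floor_le (by positivity)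
    rw [Real.norm_of_nonneg (sub_nonneg.mpr hfloor)]
    exact mul_le_one₀ (norm_moebius_le_one n) (sub_nonneg.mpr hfloor)
      (by linarith [Nat.lt_floor_add_one ((N : ℝ) / n)])
  have hmul : N * ‖∑ n ∈ Finset.Ioc 0 N, moebiusPow 1 n‖ ≤ N * 2 := by
    rw [← Complex.norm_natCast N, ← norm_mul, hsplit, Complex.norm_natCast]
    refine (norm_add_le _ _).trans ?_
    rw [norm_one]
    linarith
  exact le_of_mul_le_mul_left hmul hN0

theorem moebiusPow_mul_div_cpow (s : ℂ) {x : ℝ} (hx : 0 < x) {n : ℕ} (hn : 0 < n) :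
    moebiusPow s n * ((x / n : ℝ) : ℂ) ^ (1 - s) = (x : ℂ) ^ (1 - s) * moebiusPow 1 n := by
  have hdiv := div_cpow_ofReal_nonneg hx.le n.cast_nonneg (1 - s)
  push_cast at hdiv ⊢
  rw [hdiv, ← add_sub_cancel s 1, moebiusPow_add _ _ hn.ne', add_sub_cancel]
  ring

theorem sum_moebiusPow_mul_integral {s : ℂ} (hs : s ≠ 1) {x : ℝ} (hx : 0 < x) (N : ℕ) :
    ∑ n ∈ Finset.Ioc 0 N, moebiusPow s n * ∫ u in (1 : ℝ)..(x / n), (u : ℂ) ^ (-s) =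
      ((x : ℂ) ^ (1 - s) * ∑ n ∈ Finset.Ioc 0 N, moebiusPow 1 n -
        ∑ n ∈ Finset.Ioc 0 N, moebiusPow s n) / (1 - s) := by
  rw [Finset.mul_sum, ← Finset.sum_sub_distrib, Finset.sum_div]
  refine Finset.sum_congr rfl fun n hn => ?_
  have hn0 := (Finset.mem_Ioc.mp hn).1
  rw [integral_cpow_neg_eq hs one_pos (div_pos hx (by exact_mod_cast hn0)), ofReal_one, one_cpow,
    ← moebiusPow_mul_div_cpow s hx hn0]
  ring

section ReEqOne

variable {s : ℂ} (hs : s.re = 1)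

include hs

theorem exists_norm_sum_moebiusPow_mul_le :
    ∃ C, ∀ x : ℝ, 1 ≤ x → ‖∑ n ∈ Finset.Ioc 0 ⌊x⌋₊, moebiusPow s n *
      (∑' i : ℕ, zetaDefect s (i + 1) + ∫ u in (1 : ℝ)..(x / n), (u : ℂ) ^ (-s))‖ ≤ C := by
  refine ⟨1 + (2 * ‖s‖ + 1), fun x hx => ?_⟩
  have hx0 : 0 < x := one_pos.trans_le hx
  have hterm : ∀ n ∈ Finset.Ioc 0 ⌊x⌋₊, ‖moebiusPow s n *
      (∑ m ∈ Finset.Ioc 0 (⌊x⌋₊ / n), (m : ℂ) ^ (-s) -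
        (∑' i : ℕ, zetaDefect s (i + 1) + ∫ u in (1 : ℝ)..(x / n), (u : ℂ) ^ (-s)))‖ ≤
      (2 * ‖s‖ + 1) / x := fun n hn => by
    obtain ⟨hn0, hnx⟩ := Finset.mem_Ioc.mp hn
    have hn1 : (0 : ℝ) < n := by exact_mod_cast hn0
    have hzeta := norm_sum_cpow_neg_sub_le hs
      ((one_le_div hn1).mpr ((Nat.le_floor_iff hx0.le).mp hnx))
    have hmoebius := norm_moebiusPow_le s hn0
    rw [Nat.floor_div_natCast] at hzeta
    rw [hs, Real.rpow_neg_one] at hmoebius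
    rw [norm_mul]
    refine (mul_le_mul hmoebius hzeta (norm_nonneg _) (by positivity)).trans (le_of_eq ?_)
    field_simp
  have hsum := norm_sum_le_of_le _ hterm
  simp only [mul_sub, Finset.sum_sub_distrib] at hsum
  rw [sum_moebiusPow_mul_sum_cpow_neg s ((Nat.one_le_floor_iff x).mpr hx), norm_sub_rev,
    Finset.sum_const, Nat.card_Ioc, nsmul_eq_mul, Nat.sub_zero] at hsum
  have hcard : ⌊x⌋₊ * ((2 * ‖s‖ + 1) / x) ≤ 2 * ‖s‖ + 1 := by
    rw [mul_div_left_comm]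
    exact mul_le_of_le_one_right (by positivity) ((div_le_one hx0).mpr (Nat.floor_le hx0.le))
  have htriangle := norm_le_norm_add_norm_sub' (∑ n ∈ Finset.Ioc 0 ⌊x⌋₊, moebiusPow s n *
    (∑' i : ℕ, zetaDefect s (i + 1) + ∫ u in (1 : ℝ)..(x / n), (u : ℂ) ^ (-s))) 1
  rw [norm_one] at htriangle
  linarith

theorem exists_norm_sum_moebiusPow_le :
    ∃ C, ∀ x : ℝ, 1 ≤ x → ‖∑ n ∈ Finset.Ioc 0 ⌊x⌋₊, moebiusPow s n‖ ≤ C := by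
  rcases eq_or_ne s 1 with rfl | hs1
  · exact ⟨2, fun x _ => norm_sum_moebiusPow_one_le _⟩
  obtain ⟨C, hC⟩ := exists_norm_sum_moebiusPow_mul_le hs
  have hzeta : 0 < ‖riemannZeta s‖ := norm_pos_iff.mpr (riemannZeta_ne_zero_of_one_le_re hs.ge)
  refine ⟨(C + 1 / ‖1 - s‖ * 2) / ‖riemannZeta s‖, fun x hx => ?_⟩
  have hx0 : 0 < x := one_pos.trans_le hx
  have hsplit : riemannZeta s * ∑ n ∈ Finset.Ioc 0 ⌊x⌋₊, moebiusPow s n =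
      ∑ n ∈ Finset.Ioc 0 ⌊x⌋₊, moebiusPow s n *
        (∑' i : ℕ, zetaDefect s (i + 1) + ∫ u in (1 : ℝ)..(x / n), (u : ℂ) ^ (-s)) -
      (x : ℂ) ^ (1 - s) / (1 - s) * ∑ n ∈ Finset.Ioc 0 ⌊x⌋₊, moebiusPow 1 n := by
    simp only [mul_add, Finset.sum_add_distrib, ← Finset.sum_mul]
    rw [tsum_zetaDefect_of_re_eq_one hs hs1, sum_moebiusPow_mul_integral hs1 hx0]
    ring
  have hpow : ‖(x : ℂ) ^ (1 - s) / (1 - s)‖ = 1 / ‖1 - s‖ := by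
    rw [norm_div, norm_cpow_eq_rpow_re_of_pos hx0, sub_re, one_re, hs, sub_self, Real.rpow_zero]
  rw [le_div_iff₀ hzeta, mul_comm, ← norm_mul, hsplit]
  refine (norm_sub_le _ _).trans (add_le_add (hC x hx) ?_)
  rw [norm_mul, hpow]
  gcongr
  exact norm_sum_moebiusPow_one_le _

theorem exists_norm_sum_moebiusPow_mul_integral_le_of_re_eq_one :
    ∃ C, ∀ x : ℝ, 1 ≤ x → ‖∑ n ∈ Finset.Ioc 0 ⌊x⌋₊, moebiusPow s n *
      ∫ u in (1 : ℝ)..(x / n), (u : ℂ) ^ (-s)‖ ≤ C := by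
  obtain ⟨C, hC⟩ := exists_norm_sum_moebiusPow_mul_le hs
  obtain ⟨D, hD⟩ := exists_norm_sum_moebiusPow_le hs
  refine ⟨C + D * ‖∑' i : ℕ, zetaDefect s (i + 1)‖, fun x hx => ?_⟩
  have hsplit : ∑ n ∈ Finset.Ioc 0 ⌊x⌋₊, moebiusPow s n * ∫ u in (1 : ℝ)..(x / n), (u : ℂ) ^ (-s) =
      ∑ n ∈ Finset.Ioc 0 ⌊x⌋₊, moebiusPow s n *
        (∑' i : ℕ, zetaDefect s (i + 1) + ∫ u in (1 : ℝ)..(x / n), (u : ℂ) ^ (-s)) -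
      (∑ n ∈ Finset.Ioc 0 ⌊x⌋₊, moebiusPow s n) * ∑' i : ℕ, zetaDefect s (i + 1) := by
    simp only [mul_add, Finset.sum_add_distrib, ← Finset.sum_mul, add_sub_cancel_left]
  rw [hsplit]
  refine (norm_sub_le _ _).trans (add_le_add (hC x hx) ?_)
  rw [norm_mul]
  gcongr
  exact hD x hx

end ReEqOne

/-! ### The growth of `primTail β 0` -/

theorem exists_norm_cosTail_zero_le (hβ : 0 ≤ β.re) :
    ∃ C, ∀ u : ℝ, 0 ≤ u → ‖cosTail β 0 u‖ ≤ C := by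
  obtain ⟨C, hC⟩ := exists_norm_cosSeries_le hβ
  refine ⟨C + 1, fun u hu => ?_⟩
  rw [cosTail_zero_eq hβ]
  exact (norm_sub_le _ _).trans (add_le_add (hC u hu) norm_one.le)

theorem norm_cpow_sub_three_halves (β : ℂ) {u : ℝ} (hu : 0 < u) :
    ‖(u : ℂ) ^ (β - 3 / 2)‖ = u ^ (β.re - 3 / 2) := by
  rw [norm_cpow_eq_rpow_re_of_pos hu]
  simp

theorem exists_norm_primTail_le (hβ : 1 / 2 < β.re) :
    ∃ C, ∀ y : ℝ, 0 ≤ y → ‖primTail β 0 y‖ ≤ C := by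
  have hβ0 : 0 ≤ β.re := by linarith
  obtain ⟨C, hC⟩ := exists_norm_cosTail_zero_le hβ0
  have hint : IntegrableOn (fun t : ℝ => t ^ (β.re - 3 / 2)) (Ioc 0 1) :=
    (intervalIntegrable_iff_integrableOn_Ioc_of_le zero_le_one).mp
      (intervalIntegral.intervalIntegrable_rpow' (by linarith))
  refine ⟨∫ t in Ioc (0 : ℝ) 1, t ^ (β.re - 3 / 2) * C, fun y hy => ?_⟩
  rw [primTail_eq_integral hβ0]
  refine norm_integral_le_of_norm_le (hint.mul_const C) ?_
  filter_upwards [ae_restrict_mem measurableSet_Ioc] with t ht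
  rw [norm_mul, norm_cpow_sub_three_halves β ht.1, ← ofReal_mul]
  exact mul_le_mul_of_nonneg_left (hC _ (mul_nonneg hy ht.1.le)) (Real.rpow_nonneg ht.1.le _)

theorem primTail_eq_cpow_mul_integral (hβ : 0 ≤ β.re) {y : ℝ} (hy : 0 < y) :
    primTail β 0 y = (y : ℂ) ^ (1 / 2 - β) *
      ∫ u in (0 : ℝ)..y, (u : ℂ) ^ (β - 3 / 2) * cosTail β 0 u := by
  have hy0 : (y : ℂ) ≠ 0 := by exact_mod_cast hy.ne'
  have hscale : ∀ t ∈ Ioc (0 : ℝ) 1, (t : ℂ) ^ (β - 3 / 2) * cosTail β 0 (y * t) =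
      (y : ℂ) ^ (3 / 2 - β) *
        (((y * t : ℝ) : ℂ) ^ (β - 3 / 2) * cosTail β 0 ((y * t : ℝ) : ℂ)) := fun t ht => by
    rw [ofReal_mul, mul_cpow_ofReal_nonneg hy.le ht.1.le, ← mul_assoc, ← mul_assoc,
      ← cpow_add _ _ hy0, sub_add_sub_cancel, sub_self, cpow_zero, one_mul]
  rw [primTail_eq_integral hβ, setIntegral_congr_fun measurableSet_Ioc hscale, integral_const_mul,
    ← intervalIntegral.integral_of_le zero_le_one,
    intervalIntegral.integral_comp_mul_left (fun u : ℝ => (u : ℂ) ^ (β - 3 / 2) * cosTail β 0 u)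
      hy.ne', mul_zero, mul_one, real_smul, ← mul_assoc, ofReal_inv, ← cpow_neg_one,
    ← cpow_add _ _ hy0]
  ring_nf

theorem norm_integral_Ioi_le_of_norm_le_rpow {F : ℝ → ℂ} {C a y : ℝ} (ha : a < -1) (hy : 0 < y)
    (hF : ∀ u, y < u → ‖F u‖ ≤ C * u ^ a) :
    ‖∫ u in Ioi y, F u‖ ≤ C / (-(a + 1)) * y ^ (a + 1) := by
  have hbound := norm_integral_le_of_norm_le (μ := volume.restrict (Ioi y)) (f := F)
    ((integrableOn_Ioi_rpow_of_lt ha hy).const_mul C)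
    ((ae_restrict_mem measurableSet_Ioi).mono fun u hu => hF u hu)
  refine hbound.trans (le_of_eq ?_)
  rw [integral_const_mul, integral_Ioi_rpow_of_lt ha hy, neg_div, div_neg]
  ring

theorem sq_cpow_half_sub (β : ℂ) {y : ℝ} (hy : 0 < y) :
    ((y ^ 2 : ℝ) : ℂ) ^ (1 / 2 - β) = (y : ℂ) ^ (1 - 2 * β) := by
  have hy0 : (y : ℂ) ≠ 0 := by exact_mod_cast hy.ne'
  rw [pow_two, ofReal_mul, mul_cpow_ofReal_nonneg hy.le hy.le, ← cpow_add _ _ hy0]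
  congr 1
  ring

theorem integral_cpow_neg_one {y : ℝ} (hy : 0 < y) :
    ∫ u in (1 : ℝ)..y, (u : ℂ) ^ (-1 : ℂ) = Real.log y := by
  simp only [cpow_neg_one, ← ofReal_inv]
  rw [intervalIntegral.integral_ofReal, integral_inv_of_pos one_pos hy, div_one]

theorem sq_cpow_mul_integral (β : ℂ) {y : ℝ} (hy : 0 < y) :
    ((y ^ 2 : ℝ) : ℂ) ^ (1 / 2 - β) * ∫ u in (1 : ℝ)..(y ^ 2), (u : ℂ) ^ (β - 3 / 2) =
      2 * ∫ u in (1 : ℝ)..y, (u : ℂ) ^ (-(2 * β)) := by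
  have hy2 : 0 < y ^ 2 := by positivity
  have hy0 : ((y ^ 2 : ℝ) : ℂ) ≠ 0 := by exact_mod_cast hy2.ne'
  rcases eq_or_ne β (1 / 2) with rfl | hβ
  · rw [show (1 / 2 : ℂ) - 3 / 2 = -1 by norm_num, show -(2 * (1 / 2 : ℂ)) = -1 by norm_num,
      integral_cpow_neg_one hy2, integral_cpow_neg_one hy, sub_self, cpow_zero, one_mul,
      Real.log_pow]
    push_cast
    rfl
  · have hne : 3 / 2 - β ≠ 1 := fun h => hβ (by linear_combination -h)
    have hne' : 2 * β ≠ 1 := fun h => hβ (by linear_combination h / 2)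
    rw [show β - 3 / 2 = -(3 / 2 - β) by ring, integral_cpow_neg_eq hne one_pos hy2,
      integral_cpow_neg_eq hne' one_pos hy, ← sq_cpow_half_sub β hy, mul_div_assoc', mul_sub,
      ← cpow_add _ _ hy0, show 1 / 2 - β + (1 - (3 / 2 - β)) = 0 by ring, cpow_zero,
      show 1 - (3 / 2 - β) = β - 1 / 2 by ring, ofReal_one, one_cpow, one_cpow, mul_one,
      mul_div_assoc', div_eq_div_iff (sub_ne_zero.mpr hβ) (sub_ne_zero.mpr hne'.symm)]
    ring

theorem intervalIntegrable_cpow_mul_cosTail (hβ : 0 ≤ β.re) :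
    IntervalIntegrable (fun u : ℝ => (u : ℂ) ^ (β - 3 / 2) * cosTail β 0 u) volume 0 1 := by
  have hcont : Continuous fun u : ℝ => cosTail β 0 u :=
    (differentiable_cosTail hβ 0).continuous.comp continuous_ofReal
  have hmeas : Measurable fun u : ℝ => (u : ℂ) ^ (β - 3 / 2) * cosTail β 0 u := by
    have := hcont.measurable
    fun_prop
  rw [intervalIntegrable_iff_integrableOn_Ioc_of_le zero_le_one]
  refine Measure.integrableOn_of_bounded (M := Real.exp 1) (by simp) hmeas.aestronglyMeasurable ?_
  filter_upwards [ae_restrict_mem measurableSet_Ioc] with u hu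
  have hnorm : ‖(u : ℂ)‖ = u := by rw [norm_real, Real.norm_of_nonneg hu.1.le]
  have htail := norm_cosTail_le hβ 0 (z := u) (hnorm.trans_le hu.2)
  rw [hnorm, zero_add, mul_one] at htail
  have hpow : u ^ (β.re - 3 / 2) * u ^ 2 ≤ 1 := by
    rw [← Real.rpow_two, ← Real.rpow_add hu.1]
    exact Real.rpow_le_one hu.1.le hu.2 (by linarith)
  rw [norm_mul, norm_cpow_sub_three_halves β hu.1]
  calc u ^ (β.re - 3 / 2) * ‖cosTail β 0 u‖
      ≤ u ^ (β.re - 3 / 2) * (Real.exp 1 * u ^ 2) :=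
        mul_le_mul_of_nonneg_left htail (Real.rpow_nonneg hu.1.le _)
    _ = Real.exp 1 * (u ^ (β.re - 3 / 2) * u ^ 2) := by ring
    _ ≤ Real.exp 1 := mul_le_of_le_one_right (Real.exp_nonneg 1) hpow

theorem exists_norm_cpow_mul_cosSeries_le (hβ : 0 ≤ β.re) (hβ1 : β.re < 1) :
    ∃ C, ∀ u : ℝ, 1 ≤ u → ‖(u : ℂ) ^ (β - 3 / 2) * cosSeries β u‖ ≤ C * u ^ (-3 / 2 : ℝ) := by
  obtain ⟨C, hC⟩ := exists_norm_cosSeries_le_rpow hβ hβ1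
  refine ⟨C, fun u hu => ?_⟩
  have hu0 : 0 < u := by linarith
  rw [norm_mul, norm_cpow_sub_three_halves β hu0]
  refine (mul_le_mul_of_nonneg_left (hC u hu) (Real.rpow_nonneg hu0.le _)).trans (le_of_eq ?_)
  rw [mul_left_comm, ← Real.rpow_add hu0]
  ring_nf

theorem integrableOn_cpow_mul_cosSeries (hβ : 0 ≤ β.re) (hβ1 : β.re < 1) :
    IntegrableOn (fun u : ℝ => (u : ℂ) ^ (β - 3 / 2) * cosSeries β u) (Ioi 1) := by
  obtain ⟨C, hC⟩ := exists_norm_cpow_mul_cosSeries_le hβ hβ1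
  have hcont : Continuous fun u : ℝ => cosSeries β u :=
    (differentiable_cosSeries hβ).continuous.comp continuous_ofReal
  have hmeas : Measurable fun u : ℝ => (u : ℂ) ^ (β - 3 / 2) * cosSeries β u := by
    have := hcont.measurable
    fun_prop
  refine Integrable.mono' ((integrableOn_Ioi_rpow_of_lt (by norm_num : (-3 / 2 : ℝ) < -1)
    one_pos).const_mul C) hmeas.aestronglyMeasurable ?_
  filter_upwards [ae_restrict_mem measurableSet_Ioi] with u hu using hC u (le_of_lt hu)

theorem integral_cpow_mul_cosTail_zero_eq (hβ : 0 ≤ β.re) (hβ1 : β.re < 1) {y : ℝ} (hy : 1 ≤ y) :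
    ∫ u in (0 : ℝ)..y, (u : ℂ) ^ (β - 3 / 2) * cosTail β 0 u =
      (∫ u in (0 : ℝ)..1, (u : ℂ) ^ (β - 3 / 2) * cosTail β 0 u) +
        ((∫ u in Ioi (1 : ℝ), (u : ℂ) ^ (β - 3 / 2) * cosSeries β u) -
          ∫ u in Ioi y, (u : ℂ) ^ (β - 3 / 2) * cosSeries β u) -
        ∫ u in (1 : ℝ)..y, (u : ℂ) ^ (β - 3 / 2) := by
  have hpow := intervalIntegrable_cpow_of_pos (β - 3 / 2) one_pos (one_pos.trans_le hy)
  have hcos := integrableOn_cpow_mul_cosSeries hβ hβ1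
  have hcosy := hcos.mono_set (Ioi_subset_Ioi hy)
  have hcos1 : IntervalIntegrable (fun u : ℝ => (u : ℂ) ^ (β - 3 / 2) * cosSeries β u)
      volume 1 y :=
    hpow.mul_continuousOn
      ((differentiable_cosSeries hβ).continuous.comp continuous_ofReal).continuousOn
  have htail1 : IntervalIntegrable (fun u : ℝ => (u : ℂ) ^ (β - 3 / 2) * cosTail β 0 u)
      volume 1 y :=
    hpow.mul_continuousOn
      ((differentiable_cosTail hβ 0).continuous.comp continuous_ofReal).continuousOn
  rw [← intervalIntegral.integral_add_adjacent_intervals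
    (intervalIntegrable_cpow_mul_cosTail hβ) htail1,
    ← intervalIntegral.integral_interval_add_Ioi hcos hcosy, add_sub_cancel_right, add_sub_assoc,
    ← intervalIntegral.integral_sub hcos1 hpow]
  simp only [cosTail_zero_eq hβ, mul_sub_one]

theorem exists_norm_primTail_sub_le (hβ : 0 ≤ β.re) (hβ1 : β.re < 1) :
    ∃ (J : ℂ) (C : ℝ), ∀ y : ℝ, 1 ≤ y →
      ‖primTail β 0 ((y ^ 2 : ℝ) : ℂ) - (J * (y : ℂ) ^ (1 - 2 * β) -
        2 * ∫ u in (1 : ℝ)..y, (u : ℂ) ^ (-(2 * β)))‖ ≤ C * y ^ (-(2 * β.re)) := by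
  obtain ⟨C, hC⟩ := exists_norm_cpow_mul_cosSeries_le hβ hβ1
  refine ⟨(∫ u in (0 : ℝ)..1, (u : ℂ) ^ (β - 3 / 2) * cosTail β 0 u) +
    ∫ u in Ioi (1 : ℝ), (u : ℂ) ^ (β - 3 / 2) * cosSeries β u, 2 * C, fun y hy => ?_⟩
  have hy0 : 0 < y := by linarith
  have hy1 : 1 ≤ y ^ 2 := one_le_pow₀ hy
  have hy2 : 0 < y ^ 2 := by positivity
  have hremainder : primTail β 0 ((y ^ 2 : ℝ) : ℂ) -
      (((∫ u in (0 : ℝ)..1, (u : ℂ) ^ (β - 3 / 2) * cosTail β 0 u) +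
        ∫ u in Ioi (1 : ℝ), (u : ℂ) ^ (β - 3 / 2) * cosSeries β u) * (y : ℂ) ^ (1 - 2 * β) -
          2 * ∫ u in (1 : ℝ)..y, (u : ℂ) ^ (-(2 * β))) =
      -((y : ℂ) ^ (1 - 2 * β) *
        ∫ u in Ioi (y ^ 2), (u : ℂ) ^ (β - 3 / 2) * cosSeries β u) := by
    rw [primTail_eq_cpow_mul_integral hβ hy2, integral_cpow_mul_cosTail_zero_eq hβ hβ1 hy1,
      ← sq_cpow_mul_integral β hy0, sq_cpow_half_sub β hy0]
    ring
  have hIoi := norm_integral_Ioi_le_of_norm_le_rpow (by norm_num : (-3 / 2 : ℝ) < -1) hy2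
    fun u hu => hC u (hy1.trans hu.le)
  have hpow : (y ^ 2) ^ (-3 / 2 + 1 : ℝ) = y ^ (-1 : ℝ) := by
    rw [← Real.rpow_natCast, ← Real.rpow_mul hy0.le]
    norm_num
  rw [hremainder, norm_neg, norm_mul, norm_cpow_eq_rpow_re_of_pos hy0]
  refine (mul_le_mul_of_nonneg_left hIoi (Real.rpow_nonneg hy0.le _)).trans (le_of_eq ?_)
  rw [hpow, mul_left_comm, ← Real.rpow_add hy0]
  norm_num
  ring_nf

/-! ### The growth of `P w` -/

theorem natCast_add_one_rpow_neg_le {a : ℝ} (ha0 : 0 ≤ a) (ha : a < 1) (n : ℕ) :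
    ((n + 1 : ℕ) : ℝ) ^ (-a) ≤ (((n + 1 : ℕ) : ℝ) ^ (1 - a) - (n : ℝ) ^ (1 - a)) / (1 - a) := by
  have hle : (n : ℝ) ≤ (n + 1 : ℕ) := by simp
  have hmono := intervalIntegral.integral_mono_on_of_le_Ioo (μ := volume) hle
    intervalIntegrable_const (intervalIntegral.intervalIntegrable_rpow' (by linarith))
    fun u hu => Real.rpow_le_rpow_of_nonpos (n.cast_nonneg.trans_lt hu.1) hu.2.le
      (neg_nonpos.mpr ha0)
  rw [integral_rpow (Or.inl (by linarith)), intervalIntegral.integral_const, neg_add_eq_sub]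
    at hmono
  simpa using hmono

theorem sum_rpow_neg_le {a : ℝ} (ha0 : 0 ≤ a) (ha : a < 1) (N : ℕ) :
    ∑ n ∈ Finset.Ioc 0 N, (n : ℝ) ^ (-a) ≤ (N : ℝ) ^ (1 - a) / (1 - a) := by
  induction N with
  | zero => simp [Real.zero_rpow (sub_pos.mpr ha).ne']
  | succ N ih =>
    rw [Finset.sum_Ioc_succ_top N.zero_le]
    have hstep := natCast_add_one_rpow_neg_le ha0 ha N
    rw [sub_div] at hstep
    linarith

theorem norm_sum_moebiusPow_le_of_re_lt_one {s : ℂ} (hs0 : 0 ≤ s.re) (hs1 : s.re < 1) (N : ℕ) :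
    ‖∑ n ∈ Finset.Ioc 0 N, moebiusPow s n‖ ≤ (N : ℝ) ^ (1 - s.re) / (1 - s.re) :=
  (norm_sum_le_of_le _ fun _ hn => norm_moebiusPow_le s (Finset.mem_Ioc.mp hn).1).trans
    (sum_rpow_neg_le hs0 hs1 N)

theorem exists_norm_sum_moebiusPow_mul_integral_le {s : ℂ} (hs0 : 0 ≤ s.re) (hs1 : s.re ≤ 1) :
    ∃ C, ∀ x : ℝ, 1 ≤ x → ‖∑ n ∈ Finset.Ioc 0 ⌊x⌋₊, moebiusPow s n *
      ∫ u in (1 : ℝ)..(x / n), (u : ℂ) ^ (-s)‖ ≤ C * x ^ (1 - s.re) := by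
  rcases hs1.eq_or_lt with hs | hs
  · simpa only [hs, sub_self, Real.rpow_zero, mul_one] using
      exists_norm_sum_moebiusPow_mul_integral_le_of_re_eq_one hs
  have hne : s ≠ 1 := by
    rintro rfl
    simp at hs
  have : 0 < 1 - s.re := sub_pos.mpr hs
  refine ⟨(2 + 1 / (1 - s.re)) / ‖1 - s‖, fun x hx => ?_⟩
  have hx0 : 0 < x := one_pos.trans_le hx
  rw [sum_moebiusPow_mul_integral hne hx0, norm_div, div_mul_eq_mul_div, add_mul]
  gcongr
  refine (norm_sub_le _ _).trans (add_le_add ?_ ?_)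
  · rw [norm_mul, norm_cpow_eq_rpow_re_of_pos hx0, sub_re, one_re, mul_comm]
    gcongr
    exact norm_sum_moebiusPow_one_le _
  · refine (norm_sum_moebiusPow_le_of_re_lt_one hs0 hs _).trans ?_
    rw [div_mul_eq_mul_div, one_mul]
    gcongr
    exact Nat.floor_le hx0.le

theorem norm_sum_moebiusPow_mul_div_cpow_le (s : ℂ) {x : ℝ} (hx : 0 < x) (N : ℕ) :
    ‖∑ n ∈ Finset.Ioc 0 N, moebiusPow s n * ((x / n : ℝ) : ℂ) ^ (1 - s)‖ ≤
      2 * x ^ (1 - s.re) := by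
  have hfactor : ∑ n ∈ Finset.Ioc 0 N, moebiusPow s n * ((x / n : ℝ) : ℂ) ^ (1 - s) =
      (x : ℂ) ^ (1 - s) * ∑ n ∈ Finset.Ioc 0 N, moebiusPow 1 n := by
    rw [Finset.mul_sum]
    exact Finset.sum_congr rfl fun n hn =>
      moebiusPow_mul_div_cpow s hx (Finset.mem_Ioc.mp hn).1
  rw [hfactor, norm_mul, norm_cpow_eq_rpow_re_of_pos hx, sub_re, one_re, mul_comm]
  gcongr
  exact norm_sum_moebiusPow_one_le N

theorem norm_sum_moebiusPow_mul_le_of_norm_le {s : ℂ} {F : ℝ → ℂ} {C : ℝ}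
    (hF : ∀ y, 1 ≤ y → ‖F y‖ ≤ C * y ^ (-s.re)) {x : ℝ} (hx : 1 ≤ x) :
    ‖∑ n ∈ Finset.Ioc 0 ⌊x⌋₊, moebiusPow s n * F (x / n)‖ ≤ C * x ^ (1 - s.re) := by
  have hx0 : 0 < x := one_pos.trans_le hx
  have hC : 0 ≤ C := by simpa using (norm_nonneg _).trans (hF 1 le_rfl)
  have hterm : ∀ n ∈ Finset.Ioc 0 ⌊x⌋₊, ‖moebiusPow s n * F (x / n)‖ ≤ C * x ^ (-s.re) :=
    fun n hn => by
      obtain ⟨hn0, hnx⟩ := Finset.mem_Ioc.mp hn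
      have hn1 : (0 : ℝ) < n := by exact_mod_cast hn0
      have hFn := hF (x / n) ((one_le_div hn1).mpr ((Nat.le_floor_iff hx0.le).mp hnx))
      rw [norm_mul]
      refine (mul_le_mul (norm_moebiusPow_le s hn0) hFn (norm_nonneg _) (by positivity)).trans
        (le_of_eq ?_)
      rw [mul_left_comm, ← Real.mul_rpow hn1.le (by positivity), mul_div_cancel₀ _ hn1.ne']
  refine (norm_sum_le_of_le _ hterm).trans ?_
  rw [Finset.sum_const, Nat.card_Ioc, nsmul_eq_mul, Nat.sub_zero, mul_left_comm, sub_eq_add_neg,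
    Real.rpow_add hx0, Real.rpow_one]
  gcongr
  exact Nat.floor_le hx0.le

theorem exists_norm_sum_moebiusPow_mul_primTail_le (hβ : 0 ≤ β.re) (hβ1 : β.re ≤ 1 / 2) :
    ∃ C, ∀ x : ℝ, 1 ≤ x → ‖∑ n ∈ Finset.Ioc 0 ⌊x⌋₊, moebiusPow (2 * β) n *
      primTail β 0 (((x / n) ^ 2 : ℝ) : ℂ)‖ ≤ C * x ^ (1 - 2 * β.re) := by
  have hre : (2 * β).re = 2 * β.re := by simp
  obtain ⟨J, C, hC⟩ := exists_norm_primTail_sub_le hβ (by linarith)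
  obtain ⟨D, hD⟩ := exists_norm_sum_moebiusPow_mul_integral_le (s := 2 * β) (by linarith)
    (by linarith)
  refine ⟨‖J‖ * 2 + 2 * D + C, fun x hx => ?_⟩
  have hmain := norm_sum_moebiusPow_mul_div_cpow_le (2 * β) (one_pos.trans_le hx) ⌊x⌋₊
  have hintegral := hD x hx
  rw [← hre] at hC ⊢
  have hremainder := norm_sum_moebiusPow_mul_le_of_norm_le hC hx
  have hsplit : ∑ n ∈ Finset.Ioc 0 ⌊x⌋₊, moebiusPow (2 * β) n *
      primTail β 0 (((x / n) ^ 2 : ℝ) : ℂ) =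
      J * ∑ n ∈ Finset.Ioc 0 ⌊x⌋₊, moebiusPow (2 * β) n * ((x / n : ℝ) : ℂ) ^ (1 - 2 * β) -
      2 * (∑ n ∈ Finset.Ioc 0 ⌊x⌋₊, moebiusPow (2 * β) n *
        ∫ u in (1 : ℝ)..(x / n), (u : ℂ) ^ (-(2 * β))) +
      ∑ n ∈ Finset.Ioc 0 ⌊x⌋₊, moebiusPow (2 * β) n * (primTail β 0 (((x / n) ^ 2 : ℝ) : ℂ) -
        (J * ((x / n : ℝ) : ℂ) ^ (1 - 2 * β) -
          2 * ∫ u in (1 : ℝ)..(x / n), (u : ℂ) ^ (-(2 * β)))) := by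
    simp only [Finset.mul_sum, ← Finset.sum_sub_distrib, ← Finset.sum_add_distrib]
    exact Finset.sum_congr rfl fun n _ => by ring
  rw [hsplit, add_mul, add_mul, mul_assoc ‖J‖, mul_assoc 2 D]
  refine norm_add_le_of_le (norm_sub_le_of_le ?_ ?_) hremainder
  · rw [norm_mul]
    gcongr
  · rw [norm_mul, norm_ofNat]
    gcongr

theorem P_zero_sq_eq (hβ : 0 ≤ β.re) (x : ℝ) (N : ℕ) :
    P 0 ((x ^ 2 : ℝ) : ℂ) β = prefactor β 0 *
      (∑ n ∈ Finset.Ioc 0 N, moebiusPow (2 * β) n * primTail β 0 (((x / n) ^ 2 : ℝ) : ℂ) +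
        ∑' i : ℕ, moebiusPow (2 * β) (i + N + 1) *
          primTail β 0 (((x / (i + N + 1 : ℕ)) ^ 2 : ℝ) : ℂ)) := by
  set a : ℕ → ℂ := fun n => moebiusPow (2 * β) n * primTail β 0 (((x / n) ^ 2 : ℝ) : ℂ) with ha
  have hterm (n : ℕ+) : moebiusPow (2 * β) n *
      primTail β 0 (((x ^ 2 : ℝ) : ℂ) / ((n : ℕ) : ℂ) ^ 2) = a n := by
    simp only [ha]
    push_cast
    rw [div_pow]
  have hsum := (summable_norm_moebiusPow_mul_primTail hβ 0 ((x ^ 2 : ℝ) : ℂ)).of_norm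
  simp only [hterm] at hsum
  rw [summable_pnat_iff_summable_succ] at hsum
  have hhead : ∑ i ∈ Finset.range N, a (i + 1) = ∑ n ∈ Finset.Ioc 0 N, a n := by
    rw [Finset.range_eq_Ico, Finset.sum_Ico_add' a 0 N 1, Finset.Ico_add_one_add_one_eq_Ioc]
  rw [P_eq_tsum_moebiusPow_mul_primTail hβ]
  simp only [hterm]
  rw [tsum_pnat_eq_tsum_succ, ← hsum.sum_add_tsum_nat_add N, hhead]

theorem norm_tsum_moebiusPow_mul_primTail_le (hβ : 0 ≤ β.re) {x : ℝ} (hx : 1 ≤ x) :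
    ‖∑' i : ℕ, moebiusPow (2 * β) (i + ⌊x⌋₊ + 1) *
      primTail β 0 (((x / (i + ⌊x⌋₊ + 1 : ℕ)) ^ 2 : ℝ) : ℂ)‖ ≤
      2 * Real.exp 1 * x ^ (1 - 2 * β.re) := by
  have hx0 : 0 < x := by linarith
  have hfloor : x < ⌊x⌋₊ + 1 := Nat.lt_floor_add_one x
  have hterm (i : ℕ) : ‖moebiusPow (2 * β) (i + ⌊x⌋₊ + 1) *
      primTail β 0 (((x / (i + ⌊x⌋₊ + 1 : ℕ)) ^ 2 : ℝ) : ℂ)‖ ≤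
      x ^ (-(2 * β.re)) * (Real.exp 1 * x ^ 2) * (((i + ⌊x⌋₊ + 1 : ℕ) : ℝ) ^ 2)⁻¹ := by
    set n : ℕ := i + ⌊x⌋₊ + 1 with hn
    have hn0 : 0 < n := Nat.succ_pos _
    have hn1 : (0 : ℝ) < n := by exact_mod_cast hn0
    have hxn : x ≤ n := by
      rw [hn]
      push_cast
      linarith [i.cast_nonneg (α := ℝ)]
    have hmoebius : ‖moebiusPow (2 * β) n‖ ≤ x ^ (-(2 * β.re)) :=
      (norm_moebiusPow_le (2 * β) hn0).trans
        (by simpa using Real.rpow_le_rpow_of_nonpos hx0 hxn (z := -(2 * β.re)) (by linarith))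
    have hsq : (x / n) ^ 2 ≤ 1 := pow_le_one₀ (by positivity) ((div_le_one hn1).mpr hxn)
    have hnorm : ‖(((x / n) ^ 2 : ℝ) : ℂ)‖ = (x / n) ^ 2 := by
      rw [norm_real, Real.norm_of_nonneg (by positivity)]
    have htail := norm_primTail_le hβ 0 (hnorm.trans_le hsq)
    rw [hnorm, zero_add, mul_one, pow_two ((x / n) ^ 2)] at htail
    rw [norm_mul, mul_assoc, mul_assoc (Real.exp 1), ← div_eq_mul_inv, ← div_pow]
    exact mul_le_mul hmoebius (htail.trans (mul_le_mul_of_nonneg_left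
      (mul_le_of_le_one_left (by positivity) hsq) (Real.exp_nonneg 1))) (norm_nonneg _)
      (by positivity)
  refine (tsum_of_norm_bounded
    ((summable_inv_natCast_add_sq ⌊x⌋₊).mul_left _).hasSum hterm).trans ?_
  have hinv : ∑' i : ℕ, (((i + ⌊x⌋₊ + 1 : ℕ) : ℝ) ^ 2)⁻¹ ≤ 2 / x :=
    (tsum_inv_natCast_add_sq_le _).trans (by gcongr)
  rw [tsum_mul_left]
  refine (mul_le_mul_of_nonneg_left hinv (by positivity)).trans (le_of_eq ?_)
  rw [sub_eq_neg_add, Real.rpow_add hx0, Real.rpow_one]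
  field_simp

theorem P_zero_isBigO_one (hβ : 1 / 2 < β.re) :
    (fun r : ℝ => P 0 (r : ℂ) β) =O[atTop] (fun _ : ℝ => (1 : ℝ)) := by
  obtain ⟨C, hC⟩ := exists_norm_primTail_le hβ
  have hre : (2 * β).re = 2 * β.re := by simp
  refine .of_bound (‖prefactor β 0‖ * ∑' n : ℕ+, ((n : ℕ) : ℝ) ^ (-(2 * β).re) * C) ?_
  filter_upwards [eventually_ge_atTop 0] with r hr
  rw [norm_one, mul_one, P_eq_tsum_moebiusPow_mul_primTail (by linarith), norm_mul]
  refine mul_le_mul_of_nonneg_left (tsum_of_norm_bounded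
    ((summable_pnat_rpow_neg (by linarith)).mul_right C).hasSum fun n => ?_) (norm_nonneg _)
  have htail := hC (r / ((n : ℕ) : ℝ) ^ 2) (by positivity)
  push_cast at htail
  rw [norm_mul]
  exact mul_le_mul (norm_moebiusPow_le _ n.pos) htail (norm_nonneg _) (by positivity)

theorem P_zero_isBigO_rpow (hβ : 0 ≤ β.re) (hβ1 : β.re ≤ 1 / 2) :
    (fun r : ℝ => P 0 (r : ℂ) β) =O[atTop] (fun r : ℝ => r ^ ((1 - 2 * β.re) / 2)) := by
  obtain ⟨C, hC⟩ := exists_norm_sum_moebiusPow_mul_primTail_le hβ hβ1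
  refine .of_bound (‖prefactor β 0‖ * (C + 2 * Real.exp 1)) ?_
  filter_upwards [eventually_ge_atTop 1] with r hr
  obtain ⟨x, hx, rfl⟩ : ∃ x, 1 ≤ x ∧ x ^ 2 = r :=
    ⟨√r, Real.one_le_sqrt.mpr hr, Real.sq_sqrt (by linarith)⟩
  have hpow : (x ^ 2) ^ ((1 - 2 * β.re) / 2) = x ^ (1 - 2 * β.re) := by
    rw [← Real.rpow_two, ← Real.rpow_mul (by linarith), mul_div_cancel₀ _ two_ne_zero]
  rw [hpow, Real.norm_of_nonneg (by positivity), P_zero_sq_eq hβ x ⌊x⌋₊, norm_mul, mul_assoc,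
    add_mul]
  exact mul_le_mul_of_nonneg_left
    (norm_add_le_of_le (hC x hx) (norm_tsum_moebiusPow_mul_primTail_le hβ hx)) (norm_nonneg _)

theorem rpow_isBigO_rpow_of_le {a b : ℝ} (hab : a ≤ b) :
    (fun r : ℝ => r ^ a) =O[atTop] (fun r : ℝ => r ^ b) := by
  refine .of_bound 1 ?_
  filter_upwards [eventually_ge_atTop 1] with r hr
  rw [one_mul, Real.norm_of_nonneg (by positivity), Real.norm_of_nonneg (by positivity)]
  exact Real.rpow_le_rpow_of_exponent_le hr hab

theorem P_zero_isBigO (hβ : 0 ≤ β.re) :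
    (fun r : ℝ => P 0 (r : ℂ) β) =O[atTop]
      (fun r : ℝ => r ^ (max 0 (1 - 2 * β.re) / 2)) := by
  rcases lt_or_ge (1 / 2) β.re with hβ1 | hβ1
  · rw [max_eq_left (by linarith), zero_div]
    simpa only [Real.rpow_zero] using P_zero_isBigO_one hβ1
  · rw [max_eq_right (by linarith)]
    exact P_zero_isBigO_rpow hβ hβ1

theorem P_isBigO (hβ : 0 ≤ β.re) {w : ℕ} (hw : 1 ≤ w) :
    (fun r : ℝ => P w (r : ℂ) β) =O[atTop] (fun r : ℝ => r ^ (2 * w)) := by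
  simp only [P_eq_P_zero_add_sum hβ w, div_eq_inv_mul]
  refine .const_mul_left (.add ((P_zero_isBigO hβ).trans ?_)
    (.const_mul_left (.fun_sum fun k hk => ?_) _)) _
  · have hw1 : (1 : ℝ) ≤ w := by exact_mod_cast hw
    have hmax : max 0 (1 - 2 * β.re) ≤ 1 := max_le zero_le_one (by linarith)
    simp only [← Real.rpow_natCast]
    exact rpow_isBigO_rpow_of_le (by push_cast; linarith)
  · obtain ⟨hk1, hkw⟩ := Finset.mem_Icc.mp hk
    refine .of_bound (∑' n : ℕ+, ((n : ℕ) : ℝ) ^ (-2 : ℝ)) ?_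
    filter_upwards [eventually_ge_atTop 1] with r hr
    have hr0 : 0 ≤ r := by linarith
    refine (norm_PTerm_le hβ r hk1).trans ?_
    rw [mul_comm, norm_real, Real.norm_of_nonneg hr0, Real.norm_of_nonneg (by positivity)]
    refine mul_le_mul_of_nonneg_left ?_ (tsum_nonneg fun n => by positivity)
    exact (div_le_self (by positivity) (by exact_mod_cast Nat.factorial_pos _)).trans
      (pow_le_pow_right₀ hr (by lia))

theorem P_zero_one_div_four_isBigO {a : ℝ} (ha : 1 / 4 ≤ a) :
    (fun r : ℝ => P 0 (r : ℂ) (1 / 4)) =O[atTop] (fun r : ℝ => r ^ a) := by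
  refine (P_zero_isBigO_rpow re_one_div_four_nonneg (by norm_num)).trans
    (rpow_isBigO_rpow_of_le ?_)
  rw [re_one_div_four]
  linarith

end XiMellin

theorem mainTheorem1 :
    -- general `β` with `Re β ≥ 0`
    (∀ β : ℂ, 0 ≤ β.re →
      -- absolute convergence of the series defining `P_{4w}` and `T_0`; `P_{4w}` is entire in `z`
      (∀ (w : ℕ) (z : ℂ),
        Summable (fun j : ℕ => ‖XiMellin.PTerm z β (j + (w + 1))‖) ∧
        Summable (fun j : ℕ => ‖XiMellin.TTerm z β (j + (w + 1))‖)) ∧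
      (∀ w : ℕ, Differentiable ℂ (fun z : ℂ => XiMellin.P w z β)) ∧
      -- (1)
      (∀ s : ℂ, max 0 (1 - 2 * β.re) < s.re → s.re < 4 →
        MeasureTheory.IntegrableOn
          (fun v : ℝ => (v : ℂ) ^ (s - 1) * XiMellin.P 0 ((Real.pi * (v ^ 2)⁻¹ : ℝ) : ℂ) β)
          (Set.Ioi 0) ∧
        XiMellin.f s β =
          ∫ v in Set.Ioi (0 : ℝ),
            (v : ℂ) ^ (s - 1) * XiMellin.P 0 ((Real.pi * (v ^ 2)⁻¹ : ℝ) : ℂ) β) ∧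
      -- (2)
      (∀ w : ℕ, 1 ≤ w → ∀ s : ℂ, 4 * (w : ℝ) < s.re → s.re < 4 * ((w : ℝ) + 1) →
        MeasureTheory.IntegrableOn
          (fun v : ℝ => (v : ℂ) ^ (s - 1) * XiMellin.P w ((Real.pi * (v ^ 2)⁻¹ : ℝ) : ℂ) β)
          (Set.Ioi 0) ∧
        (-1) ^ w * XiMellin.f s β =
          ∫ v in Set.Ioi (0 : ℝ),
            (v : ℂ) ^ (s - 1) * XiMellin.P w ((Real.pi * (v ^ 2)⁻¹ : ℝ) : ℂ) β) ∧
      -- (3), the sum over `n ≥ 1`, absolutely convergent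
      (∀ (w : ℕ) (z : ℂ),
        Summable (fun n : ℕ+ =>
          ‖((ArithmeticFunction.moebius (n : ℕ) : ℤ) : ℂ) / ((n : ℕ) : ℂ) ^ (2 * β) *
            XiMellin.T0 (Complex.I * z / ((n : ℕ) : ℂ) ^ 2) β w‖) ∧
        XiMellin.P w (Real.pi * z) β =
          ∑' n : ℕ+, ((ArithmeticFunction.moebius (n : ℕ) : ℤ) : ℂ) / ((n : ℕ) : ℂ) ^ (2 * β) *
            XiMellin.T0 (Complex.I * z / ((n : ℕ) : ℂ) ^ 2) β w) ∧
      -- (4)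
      ((fun r : ℝ => XiMellin.P 0 (r : ℂ) β) =O[Filter.atTop]
        (fun r : ℝ => r ^ (max 0 (1 - 2 * β.re) / 2))) ∧
      (∀ w : ℕ, 1 ≤ w →
        (fun r : ℝ => XiMellin.P w (r : ℂ) β) =O[Filter.atTop] (fun r : ℝ => r ^ (2 * w)))) ∧
    -- `β = 1/4`: the two-sided Laplace transform on `1/2 < Re s < 4`
    AnalyticOnNhd ℂ (fun s : ℂ => XiMellin.f s (1 / 4)) {s : ℂ | 1 / 2 < s.re ∧ s.re < 4} ∧
    (∀ s : ℂ, 1 / 2 < s.re → s.re < 4 →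
      MeasureTheory.Integrable
        (fun y : ℝ => Complex.exp (s * y) *
          XiMellin.P 0 ((Real.pi * Real.exp (-2 * y) : ℝ) : ℂ) (1 / 4)) ∧
      XiMellin.f s (1 / 4) =
        ∫ y : ℝ, Complex.exp (s * y) *
          XiMellin.P 0 ((Real.pi * Real.exp (-2 * y) : ℝ) : ℂ) (1 / 4)) ∧
    (∀ z : ℂ,
      XiMellin.P 0 z (1 / 4) =
          (4 / ((Real.pi : ℂ) ^ (3 / 4 : ℂ) * Complex.Gamma (1 / 4))) *
            (-1 * ∑' j : ℕ, (-z ^ 2) ^ (j + 1) /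
              (XiMellin.poch (5 / 4) (2 * (j + 1)) * (2 * ((j + 1 : ℕ) : ℂ) - 1 / 4) *
                riemannZeta (1 / 2 + 4 * ((j + 1 : ℕ) : ℂ)))) ∧
      XiMellin.P 0 z (1 / 4) = -1 * ∑' j : ℕ, XiMellin.cTilde (j + 1) * (-z ^ 2) ^ (j + 1)) ∧
    -- `β = 1/4`: the strips `4w < Re s < 4w + 4` with `w ≥ 1`
    (∀ w : ℕ, 1 ≤ w →
      AnalyticOnNhd ℂ (fun s : ℂ => XiMellin.f s (1 / 4))
        {s : ℂ | 4 * (w : ℝ) < s.re ∧ s.re < 4 * ((w : ℝ) + 1)} ∧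
      (∀ s : ℂ, 4 * (w : ℝ) < s.re → s.re < 4 * ((w : ℝ) + 1) →
        MeasureTheory.Integrable
          (fun y : ℝ => Complex.exp (s * y) *
            XiMellin.P w ((Real.pi * Real.exp (-2 * y) : ℝ) : ℂ) (1 / 4)) ∧
        (-1) ^ w * XiMellin.f s (1 / 4) =
          ∫ y : ℝ, Complex.exp (s * y) *
            XiMellin.P w ((Real.pi * Real.exp (-2 * y) : ℝ) : ℂ) (1 / 4)) ∧
      (∀ z : ℂ,
        XiMellin.P w z (1 / 4) =
          (-1) ^ w * (XiMellin.P 0 z (1 / 4) +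
            ∑ k ∈ Finset.Icc 1 w, XiMellin.cTilde k * (-z ^ 2) ^ k) ∧
        XiMellin.P w z (1 / 4) =
          (-1) ^ (w + 1) *
            ∑' j : ℕ, XiMellin.cTilde (j + (w + 1)) * (-z ^ 2) ^ (j + (w + 1)))) ∧
    -- `β = 1/4`: the growth of `P_0`
    (∀ ε : ℝ, 0 < ε →
      (fun v : ℝ => XiMellin.P 0 (v : ℂ) (1 / 4)) =O[Filter.atTop]
        (fun v : ℝ => v ^ (1 / 4 + ε))) := by
  have hre : 1 - 2 * ((1 : ℂ) / 4).re = 1 / 2 := by norm_num [XiMellin.re_one_div_four]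
  have hquarter := XiMellin.re_one_div_four_nonneg
  have hcast {w : ℕ} (hw : 1 ≤ w) : (1 : ℝ) ≤ w := by exact_mod_cast hw
  refine ⟨fun β hβ => ⟨fun w z => ⟨XiMellin.summable_norm_PTerm hβ w z,
      XiMellin.summable_norm_TTerm hβ w z⟩, XiMellin.differentiable_P hβ,
      fun s hs hs4 => ?_, fun w hw s hs hs4 => ?_,
      fun w z => ⟨XiMellin.summable_norm_moebiusPow_mul_T0 hβ w z,
        XiMellin.P_pi_mul_eq_tsum_moebiusPow_mul_T0 hβ w z⟩,
      XiMellin.P_zero_isBigO hβ, fun w hw => XiMellin.P_isBigO hβ hw⟩,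
    by simpa using XiMellin.analyticOnNhd_f 0 (by norm_num) hre.le, fun s hs hs4 => ?_,
    fun z => ⟨XiMellin.P_zero_one_div_four_eq_tsum_poch z,
      by simpa using XiMellin.P_one_div_four_eq_tsum_cTilde 0 z⟩,
    fun w hw => ⟨XiMellin.analyticOnNhd_f w le_rfl (by linarith [hcast hw]), fun s hs hs4 => ?_,
      fun z => ⟨XiMellin.P_one_div_four_eq_P_zero_add w z,
        XiMellin.P_one_div_four_eq_tsum_cTilde w z⟩⟩,
    fun ε hε => XiMellin.P_zero_one_div_four_isBigO (by linarith)⟩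
  · obtain ⟨hs0, hβs⟩ := max_lt_iff.mp hs
    simpa using XiMellin.integrableOn_and_f_eq_integral_P (w := 0) (by simp [hs0, hs4]) hβ hβs
  · exact XiMellin.integrableOn_and_f_eq_integral_P ⟨hs, hs4⟩ hβ (by linarith [hcast hw])
  · simpa using XiMellin.integrable_and_f_eq_integral_exp_mul_P (w := 0)
      (by constructor <;> push_cast <;> linarith) hquarter (hre.trans_lt hs)
  · exact XiMellin.integrable_and_f_eq_integral_exp_mul_P ⟨hs, hs4⟩ hquarter
      (by linarith [hcast hw])
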